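/- Let $\mathcal P$ be a finite-dimensional smooth manifold (Hausdorff, second countable, without boundary), let $\omega$ be a presymplectic form on $\mathcal P$ (a smooth closed 2-form, possibly degenerate), and let $\mathcal C\subset\mathcal P$ be a smooth embedded submanifold, for instance the final constraint submanifold of a Hamiltonian system on $(\mathcal P,\omega)$. For a subspace $W\subset T_p\mathcal P$ let $W^\perp=\{V\in T_p\mathcal P:\omega(V,W')=0\text{ for all }W'\in W\}$; write $T\mathcal P^\perp$ and $T\mathcal C^\perp$ for the families $(T_p\mathcal P)^\perp$ and $(T_p\mathcal C)^\perp$, $p\in\mathcal C$. For a smooth function $f$ and a family $W$ of subspaces, $W[f]=0$ means that $df$ vanishes on every vector of $W$. A *constraint* is a smooth function $f:\mathcal P\to\mathbb R$ that vanishes on $\mathcal C$; it is *first class* if $T\mathcal C^\perp[f]=0$ everywhere on $\mathcal C$. A vector $V\in T_p\mathcal P$ is a *Hamiltonian vector of $f$ at $p$* if $\mathbf i_V\omega_p=df(p)$. A *Hamiltonian vector field of $f$ along $\mathcal C$* is a smooth section $X_f$ of $T\mathcal P|_{\mathcal C}$ with $\mathbf i_{X_f}\omega=df$ at all points of $\mathcal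 C$ (it is determined only up to $\ker\omega=T\mathcal P^\perp$). A family of subspaces of the spaces $T_p\mathcal P$, $p\in\mathcal C$, is *regular near* $p\in\mathcal C$ if its dimension is constant on a neighbourhood of $p$ in $\mathcal C$, and *regular* if it is regular near every point of $\mathcal C$. Then: (i) Let $f$ be a constraint. Then $f$ has a Hamiltonian vector at every point of $\mathcal C$ if and only if $T\mathcal P^\perp[f]|_{\mathcal C}=0$; if $T\mathcal P^\perp|_{\mathcal C}$ is regular, then $f$ has a Hamiltonian vector field along $\mathcal C$ if and only if $T\mathcal P^\perp[f]|_{\mathcal C}=0$. Every Hamiltonian vector of $f$ at a point $p\in\mathcal C$ lies in $T_p\mathcal C^\perp$. (ii) At every point $p\in\mathcal C$, $T_p\mathcal C^\perp$ is spanned by the Hamiltonian vectors at $p$ of constraints; if $T\mathcal C^\perp$ is regular near $p$, then $T_p\mathcal C^\perp$ is spanned by the values at $p$ of the Hamiltonian vector fields along $\mathcal C$ of constraints. (iii) Let $f$ be a first class constraint. Then at every point $p\in\mathcal C$ it has a Hamiltonian vector lying in $T_p\mathcal C\cap T_p\mathcal C^\perp$; if $T\mathcal C^\perp$ is regular, then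 $f$ has a Hamiltonian vector field along $\mathcal C$ that is a smooth vector field on $\mathcal C$ (everywhere tangent to $\mathcal C$) and takes its values in $T\mathcal C\cap T\mathcal C^\perp$. (iv) At every point $p\in\mathcal C$ near which $T\mathcal C\cap T\mathcal C^\perp$ is regular, $T_p\mathcal C\cap T_p\mathcal C^\perp$ is spanned by the values at $p$ of those Hamiltonian vector fields along $\mathcal C$ of first class constraints that are smooth vector fields on $\mathcal C$. -/

import Mathlib

open Set Filter Topology Manifold
open scoped ContDiff

noncomputable section

/-- A (not necessarily smooth) 2-form on a manifold `P` modelled on `E`. -/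
abbrev TwoForm (E : Type*) [NormedAddCommGroup E] [NormedSpace ℝ E]
    (P : Type*) [TopologicalSpace P] [ChartedSpace E P] :=
  ∀ p : P, TangentSpace 𝓘(ℝ, E) p [⋀^Fin 2]→L[ℝ] ℝ

/-- The local representative of a 2-form in the preferred chart `φ` at `x`, that is, the
pullback `(φ⁻¹)^* Ω`, a 2-form on the vector space `E` (meaningful on the open set `φ.target`). -/
def TwoForm.inChart {E : Type*} [NormedAddCommGroup E] [NormedSpace ℝ E]
    {P : Type*} [TopologicalSpace P] [ChartedSpace E P]
    (Ω : TwoForm E P) (x : P) (y : E) : E [⋀^Fin 2]→L[ℝ] ℝ :=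
  (Ω ((extChartAt 𝓘(ℝ, E) x).symm y)).compContinuousLinearMap
    (mfderiv 𝓘(ℝ, E) 𝓘(ℝ, E) (extChartAt 𝓘(ℝ, E) x).symm y)

/-- A presymplectic form: a smooth closed 2-form, possibly degenerate. Smoothness and closedness
(`d Ω = 0`) are expressed in the charts of the manifold. -/
structure PresymplecticForm (E : Type*) [NormedAddCommGroup E] [NormedSpace ℝ E]
    (P : Type*) [TopologicalSpace P] [ChartedSpace E P] where
  /-- The underlying 2-form. -/
  form : TwoForm E P
  smooth : ∀ x : P, ContDiffOn ℝ ∞ (form.inChart x) (extChartAt 𝓘(ℝ, E) x).target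
  closed : ∀ x : P, ∀ y ∈ (extChartAt 𝓘(ℝ, E) x).target, extDeriv (form.inChart x) y = 0

section

variable {E : Type*} [NormedAddCommGroup E] [NormedSpace ℝ E]
  {P : Type*} [TopologicalSpace P] [ChartedSpace E P]
  {F : Type*} [NormedAddCommGroup F] [NormedSpace ℝ F]
  {C : Type*} [TopologicalSpace C] [ChartedSpace F C]

/-- The symplectic polar `W^⊥ = {V ∈ T_p P | Ω(V, W') = 0 for all W' ∈ W}` of a subspace `W`
of `T_p P`. -/
def PresymplecticForm.polar (Ω : PresymplecticForm E P) {p : P}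
    (W : Submodule ℝ (TangentSpace 𝓘(ℝ, E) p)) : Submodule ℝ (TangentSpace 𝓘(ℝ, E) p) where
  carrier := {V | ∀ W' ∈ W, Ω.form p ![V, W'] = 0}
  add_mem' {a b} ha hb W' hW' := by
    rw [(Ω.form p).vecCons_add, ha W' hW', hb W' hW', add_zero]
  zero_mem' W' _ := (Ω.form p).map_coord_zero 0 rfl
  smul_mem' c a ha W' hW' := by
    rw [(Ω.form p).vecCons_smul, ha W' hW', smul_zero]

/-- The tangent space at `q` of the submanifold `ι : C → P`, as a subspace of `T_{ι q} P`. -/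
def subTangent (ι : C → P) (q : C) : Submodule ℝ (TangentSpace 𝓘(ℝ, E) (ι q)) :=
  LinearMap.range (mfderiv 𝓘(ℝ, F) 𝓘(ℝ, E) ι q).toLinearMap

/-- `V ∈ T_p P` solves `i_V Ω = d f` at the point `p`: `Ω(V, W) = df(W)` for all `W ∈ T_p P`. -/
def PresymplecticForm.IsHamiltonianVector (Ω : PresymplecticForm E P) (f : P → ℝ) {p : P}
    (V : TangentSpace 𝓘(ℝ, E) p) : Prop :=
  ∀ W : TangentSpace 𝓘(ℝ, E) p, Ω.form p ![V, W] = mvfderiv 𝓘(ℝ, E) f p W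

/-- `W[f] = 0` for a subspace `W` of `T_p P`: the derivative of `f` along each vector of `W`
vanishes. -/
def DerivVanishesOn (f : P → ℝ) {p : P} (W : Submodule ℝ (TangentSpace 𝓘(ℝ, E) p)) : Prop :=
  ∀ V ∈ W, mvfderiv 𝓘(ℝ, E) f p V = 0

variable (E) in
/-- A constraint: a smooth function on `P` that vanishes on the submanifold `ι : C → P`. -/
structure IsConstraint (ι : C → P) (f : P → ℝ) : Prop where
  smooth : ContMDiff 𝓘(ℝ, E) 𝓘(ℝ, ℝ) ∞ f
  vanishes : ∀ q : C, f (ι q) = 0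

/-- A first class constraint: a constraint `f` with `TC^⊥[f] = 0` everywhere on `C`. -/
structure PresymplecticForm.IsFirstClass (Ω : PresymplecticForm E P) (F : Type*)
    [NormedAddCommGroup F] [NormedSpace ℝ F] [ChartedSpace F C] (ι : C → P) (f : P → ℝ) : Prop
    extends IsConstraint E ι f where
  firstClass : ∀ q : C, DerivVanishesOn f (Ω.polar (subTangent (F := F) ι q))

variable (F) in
/-- `X` is a smooth vector field along `C` (a smooth section of `TP` over `C`) with
`i_X Ω = d f` at the points of `C`: a Hamiltonian vector field of `f` along `C`. -/
structure PresymplecticForm.IsHamiltonianFieldAlong [IsManifold 𝓘(ℝ, E) ∞ P]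
    (Ω : PresymplecticForm E P) (ι : C → P)
    (f : P → ℝ) (X : ∀ q : C, TangentSpace 𝓘(ℝ, E) (ι q)) : Prop where
  smooth : ContMDiff 𝓘(ℝ, F) 𝓘(ℝ, E).tangent ∞
    (fun q => (⟨ι q, X q⟩ : TangentBundle 𝓘(ℝ, E) P))
  hamiltonian : ∀ q : C, Ω.IsHamiltonianVector f (X q)

/-- `Y` is a smooth vector field on the manifold `C`. -/
def IsSmoothField [IsManifold 𝓘(ℝ, F) ∞ C] (Y : ∀ q : C, TangentSpace 𝓘(ℝ, F) q) : Prop :=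
  ContMDiff 𝓘(ℝ, F) 𝓘(ℝ, F).tangent ∞ (fun q => (⟨q, Y q⟩ : TangentBundle 𝓘(ℝ, F) C))

/-- The vector field on `C` seen as a vector field along `C` with values in `TP`. -/
def pushField (ι : C → P) (Y : ∀ q : C, TangentSpace 𝓘(ℝ, F) q) (q : C) :
    TangentSpace 𝓘(ℝ, E) (ι q) :=
  mfderiv 𝓘(ℝ, F) 𝓘(ℝ, E) ι q (Y q)

/-- A family of subspaces `D q ⊆ T_{ι q} P` has constant dimension near the point `q` of `C`. -/
def HasConstantRankNear (ι : C → P) (D : ∀ q : C, Submodule ℝ (TangentSpace 𝓘(ℝ, E) (ι q)))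
    (q : C) : Prop :=
  ∀ᶠ q' in 𝓝 q, Module.finrank ℝ (D q') = Module.finrank ℝ (D q)

end

end

open Set Filter Topology Manifold
open scoped ContDiff

/-! Pointwise the theorem is linear algebra. For a linear map `L` into a tangent space, a covector
has the form i_V ω with V in the image of `L` exactly when it vanishes on the polar of that image,
by double annihilators in finite dimension and antisymmetry of ω. Applied to df, `L = id` gives the
criterion in (i) and `L = dι` gives the tangent Hamiltonian vectors in (iii).

Smooth versions rest on `exists_local_solution`: a smooth linear system of constant rank, solvable
at each point, is smoothly solvable locally. Regularity of the polars is constancy of that rank, and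
since the Hamiltonian vectors of f form an affine set, a partition of unity glues local solutions.

The spanning statements need constraints with prescribed differential. With a local retraction r of
P onto C, a chart χ, and a covector field A along C that kills TC, the function p ↦ A(r(p))(χ(p) −
χ(ι(r(p)))) vanishes on C and has differential A there (`exists_constraint`). For A = i_v ω, killing
TC means that v lies in the polar of TC, so a cut-off of v is a Hamiltonian field of a constraint. A
vector of TC^⊥, or of TC ∩ TC^⊥, extends to such a v by `exists_local_kernel_section`, because these
families are kernels of smooth linear maps of constant rank. If v is tangent to C, antisymmetry
makes the constraint first class. -/

noncomputable section

/-! ### Smooth linear systems of constant rank. -/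

section Analysis

variable {F : Type*} [NormedAddCommGroup F] [NormedSpace ℝ F]
  {C : Type*} [TopologicalSpace C] [ChartedSpace F C]
  {G : Type*} [NormedAddCommGroup G] [NormedSpace ℝ G] [FiniteDimensional ℝ G]
  {H : Type*} [NormedAddCommGroup H] [NormedSpace ℝ H]

/-- A map into a space of linear maps out of a finite-dimensional space is smooth if all its
evaluations are. -/
theorem contMDiffAt_clm_of_apply {A : C → G →L[ℝ] H} {c : C}
    (hA : ∀ u, ContMDiffAt 𝓘(ℝ, F) 𝓘(ℝ, H) ∞ (fun x => A x u) c) :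
    ContMDiffAt 𝓘(ℝ, F) 𝓘(ℝ, G →L[ℝ] H) ∞ A c := by
  let b := Module.finBasis ℝ G
  let k (i) : H →L[ℝ] G →L[ℝ] H :=
    ContinuousLinearMap.smulRightL ℝ G H (LinearMap.toContinuousLinearMap (b.coord i))
  have h : A = fun x => ∑ i, k i (A x (b i)) := by
    funext x
    ext u
    calc A x u = A x (∑ i, b.repr u i • b i) := by rw [b.sum_repr]
      _ = ∑ i, b.repr u i • A x (b i) := by simp only [map_sum, map_smul]
      _ = _ := by simp [k]
  rw [h]
  exact contMDiffAt_finsetSum fun i _ => (k i).contMDiff.contMDiffAt.comp c (hA (b i))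

/-- A smooth linear system of constant rank which is solvable at every point has a smooth
local solution. -/
theorem exists_local_solution [FiniteDimensional ℝ H] {A : C → G →L[ℝ] H} {b : C → H} {c₀ : C}
    (hA : ∀ᶠ c in 𝓝 c₀, ContMDiffAt 𝓘(ℝ, F) 𝓘(ℝ, G →L[ℝ] H) ∞ A c)
    (hb : ∀ᶠ c in 𝓝 c₀, ContMDiffAt 𝓘(ℝ, F) 𝓘(ℝ, H) ∞ b c)
    (hrank : ∀ᶠ c in 𝓝 c₀, Module.finrank ℝ (LinearMap.range (A c).toLinearMap) =
      Module.finrank ℝ (LinearMap.range (A c₀).toLinearMap))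
    (hrange : ∀ᶠ c in 𝓝 c₀, b c ∈ LinearMap.range (A c).toLinearMap) :
    ∃ v : C → G, (∀ᶠ c in 𝓝 c₀, ContMDiffAt 𝓘(ℝ, F) 𝓘(ℝ, G) ∞ v c) ∧
      (∀ᶠ c in 𝓝 c₀, A c (v c) = b c) ∧ (b c₀ = 0 → v c₀ = 0) := by
  let R := LinearMap.range (A c₀).toLinearMap
  obtain ⟨i₀, hi₀⟩ := (A c₀).toLinearMap.rangeRestrict.exists_rightInverse_of_surjective
    (LinearMap.range_rangeRestrict _)
  obtain ⟨p₀, hp₀⟩ := R.subtype.exists_leftInverse_of_injective (Submodule.ker_subtype R)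
  let i : R →L[ℝ] G := LinearMap.toContinuousLinearMap i₀
  let p : H →L[ℝ] R := LinearMap.toContinuousLinearMap p₀
  -- Compressing `A c` by a section `i` of `A c₀` and a projection `p` onto its range gives the
  -- identity at `c₀`, hence an invertible map nearby.
  let M (c : C) : R →L[ℝ] R := p ∘L A c ∘L i
  have hM₀ : M c₀ = ContinuousLinearEquiv.refl ℝ R := by
    ext1 r
    have h1 : A c₀ (i₀ r) = R.subtype r := congrArg Subtype.val (LinearMap.congr_fun hi₀ r)
    have h2 := LinearMap.congr_fun hp₀ r
    change p₀ (A c₀ (i₀ r)) = r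
    rw [h1]
    exact h2
  have hM : ∀ᶠ c in 𝓝 c₀, ContMDiffAt 𝓘(ℝ, F) 𝓘(ℝ, R →L[ℝ] R) ∞ M c := by
    filter_upwards [hA] with c hc
    exact contMDiffAt_const.clm_comp (hc.clm_comp contMDiffAt_const)
  have hinv : ∀ᶠ c in 𝓝 c₀, (M c).IsInvertible := by
    have h := (ContinuousLinearEquiv.refl ℝ R).nhds
    rw [← hM₀] at h
    exact hM.self_of_nhds.continuousAt.eventually h
  refine ⟨fun c => i ((M c).inverse (p (b c))), ?_, ?_, ?_⟩
  · filter_upwards [hM, hinv, hb] with c h1 h2 h3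
    have h4 : ContMDiffAt 𝓘(ℝ, F) 𝓘(ℝ, R →L[ℝ] R) ∞ (fun c => (M c).inverse) c :=
      h2.contDiffAt_map_inverse.contMDiffAt.comp c h1
    exact i.contMDiff.contMDiffAt.comp c (h4.clm_apply (p.contMDiff.contMDiffAt.comp c h3))
  · filter_upwards [hinv, hrank, hrange] with c h1 h2 h3
    let Rc := LinearMap.range (A c).toLinearMap
    let q : Rc →ₗ[ℝ] R := p.toLinearMap ∘ₗ Rc.subtype
    have hMv (r : R) : p (A c (i ((M c).inverse r))) = r := by
      obtain ⟨e, he⟩ := h1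
      have : M c ((M c).inverse r) = r := by rw [← he]; simp
      exact this
    have hsurj : Function.Surjective q := fun r =>
      ⟨⟨A c (i ((M c).inverse r)), LinearMap.mem_range_self _ _⟩, hMv r⟩
    -- This is where constant rank enters: `p` maps the range of `A c` onto `R`, of equal dimension,
    -- so it is injective there, and the equation holds as soon as it holds after `p`.
    have hinj := (LinearMap.injective_iff_surjective_of_finrank_eq_finrank h2).2 hsurj
    have := @hinj ⟨A c (i ((M c).inverse (p (b c)))), LinearMap.mem_range_self _ _⟩ ⟨b c, h3⟩
      (hMv (p (b c)))
    exact congrArg Subtype.val this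
  · intro h
    simp [h]

/-- A vector in the kernel of a smooth family of linear maps of constant rank extends to a smooth
local section of the kernels. -/
theorem exists_local_kernel_section [FiniteDimensional ℝ H] {A : C → G →L[ℝ] H} {c₀ : C}
    (hA : ∀ᶠ c in 𝓝 c₀, ContMDiffAt 𝓘(ℝ, F) 𝓘(ℝ, G →L[ℝ] H) ∞ A c)
    (hker : ∀ᶠ c in 𝓝 c₀, Module.finrank ℝ (LinearMap.ker (A c).toLinearMap) =
      Module.finrank ℝ (LinearMap.ker (A c₀).toLinearMap))
    {v₀ : G} (hv₀ : A c₀ v₀ = 0) :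
    ∃ v : C → G, (∀ᶠ c in 𝓝 c₀, ContMDiffAt 𝓘(ℝ, F) 𝓘(ℝ, G) ∞ v c) ∧
      (∀ᶠ c in 𝓝 c₀, A c (v c) = 0) ∧ v c₀ = v₀ := by
  -- The constant section `v₀` is corrected by a solution of `A c (w c) = A c v₀` that vanishes at
  -- `c₀`.
  obtain ⟨w, h1, h2, h3⟩ := exists_local_solution (b := fun c => A c v₀) hA
    (hA.mono fun c hc => hc.clm_apply contMDiffAt_const)
    (hker.mono fun c hc => by
      have h := (A c).toLinearMap.finrank_range_add_finrank_ker
      have h' := (A c₀).toLinearMap.finrank_range_add_finrank_ker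
      omega)
    (Eventually.of_forall fun c => LinearMap.mem_range_self _ _)
  refine ⟨fun c => v₀ - w c, h1.mono fun c hc => contMDiffAt_const.sub hc, ?_, by simp [h3 hv₀]⟩
  filter_upwards [h2] with c hc
  simp [hc]

end Analysis

/-! ### Annihilators in finite dimension. -/

section LinearAlgebra

variable {V : Type*} [NormedAddCommGroup V] [NormedSpace ℝ V] [FiniteDimensional ℝ V]
  {U : Type*} [AddCommGroup U] [Module ℝ U]

/-- A linear form that vanishes wherever all the forms `A u` do is one of the `A u`. -/
theorem exists_eq_of_forall_vanish (A : U →ₗ[ℝ] V →L[ℝ] ℝ) (α : V →L[ℝ] ℝ)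
    (h : ∀ v, (∀ u, A u v = 0) → α v = 0) : ∃ u, A u = α := by
  let A' : U →ₗ[ℝ] Module.Dual ℝ V := (ContinuousLinearMap.coeLM ℝ) ∘ₗ A
  have : α.toLinearMap ∈ LinearMap.range A' := by
    rw [← Subspace.dualCoannihilator_dualAnnihilator_eq (W := LinearMap.range A'),
      Submodule.mem_dualAnnihilator]
    intro v hv
    rw [Submodule.mem_dualCoannihilator] at hv
    exact h v fun u => hv _ (LinearMap.mem_range_self A' u)
  obtain ⟨u, hu⟩ := this
  exact ⟨u, ContinuousLinearMap.coe_injective hu⟩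

/-- The rank of a family of linear forms is the codimension of its common kernel. -/
theorem finrank_range_add_finrank_of_forall_mem_iff (A : U →ₗ[ℝ] V →L[ℝ] ℝ)
    {T : Type*} [AddCommGroup T] [Module ℝ T] (e : T ≃ₗ[ℝ] V)
    (K : Submodule ℝ T) (hK : ∀ v, v ∈ K ↔ ∀ u, A u (e v) = 0) :
    Module.finrank ℝ (LinearMap.range A) + Module.finrank ℝ K = Module.finrank ℝ V := by
  let j : (V →L[ℝ] ℝ) →ₗ[ℝ] Module.Dual ℝ V := ContinuousLinearMap.coeLM ℝ
  have hj : Function.Injective j := ContinuousLinearMap.coe_injective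
  have h1 : K.map e.toLinearMap = (LinearMap.range (j ∘ₗ A)).dualCoannihilator := by
    ext v
    obtain ⟨w, rfl⟩ := e.surjective v
    have : e w ∈ K.map e.toLinearMap ↔ w ∈ K := by simp
    rw [this, hK, Submodule.mem_dualCoannihilator]
    exact ⟨fun h φ ⟨u, hu⟩ => hu ▸ h u, fun h u => h _ (LinearMap.mem_range_self _ u)⟩
  have h2 : Module.finrank ℝ (LinearMap.range (j ∘ₗ A)) =
      Module.finrank ℝ (LinearMap.range A) := by
    rw [LinearMap.range_comp]
    exact (Submodule.equivMapOfInjective j hj _).finrank_eq.symm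
  rw [← h2, ← LinearEquiv.finrank_map_eq e K, h1]
  exact Subspace.finrank_add_finrank_dualCoannihilator_eq _

end LinearAlgebra

/-! ### Local retractions onto an embedded submanifold. -/

section Embedding

variable {E : Type*} [NormedAddCommGroup E] [NormedSpace ℝ E]
  {P : Type*} [TopologicalSpace P] [ChartedSpace E P]
  {F : Type*} [NormedAddCommGroup F] [NormedSpace ℝ F]
  {C : Type*} [TopologicalSpace C] [ChartedSpace F C]
  {ι : C → P}

/-- Near each of its points, an embedded submanifold is a smooth retract. -/
theorem exists_local_retraction (hι : IsSmoothEmbedding 𝓘(ℝ, F) 𝓘(ℝ, E) ∞ ι) (q₀ : C) :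
    ∃ (U : Set P) (r : P → C), IsOpen U ∧ ι q₀ ∈ U ∧ ContMDiffOn 𝓘(ℝ, E) 𝓘(ℝ, F) ∞ r U ∧
      ∀ c, ι c ∈ U → r (ι c) = c := by
  have h := hι.isImmersion.isImmersionAt q₀
  -- The topological embedding is needed here: inside `U₀` no other part of the submanifold returns
  -- near `ι q₀`.
  obtain ⟨U₀, hU₀, hU₀'⟩ := hι.isEmbedding.isOpen_iff.1 h.domChart.open_source
  -- In the slice chart, `s` projects onto the coordinates along the submanifold; `domChart.symm ∘
  -- s` is the retraction.
  let s : P → F := fun p => (h.equiv.symm (h.codChart p)).1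
  have key (c : C) (hc : c ∈ h.domChart.source) : s (ι c) = h.domChart c := by
    have hc' : h.domChart c ∈ (h.domChart.extend 𝓘(ℝ, F)).target := by
      simpa using h.domChart.map_source hc
    have h1 := h.writtenInCharts hc'
    have h2 : h.codChart (ι c) = h.equiv (h.domChart c, 0) := by
      simpa [h.domChart.left_inv hc] using h1
    simp [s, h2]
  have hs : ContMDiffOn 𝓘(ℝ, E) 𝓘(ℝ, F) ∞ s h.codChart.source := by
    have h1 := contMDiffOn_of_mem_maximalAtlas h.codChart_mem_maximalAtlas
    have h2 : ContDiff ℝ ∞ (fun y : E => (h.equiv.symm y).1) :=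
      contDiff_fst.comp h.equiv.symm.contDiff
    exact h2.contMDiff.comp_contMDiffOn h1
  have hmem (c : C) (hc : c ∈ h.domChart.source) :
      ι c ∈ h.codChart.source ∩ s ⁻¹' h.domChart.target :=
    ⟨h.source_subset_preimage_source hc, by
      rw [mem_preimage, key c hc]
      exact h.domChart.map_source hc⟩
  refine ⟨U₀ ∩ (h.codChart.source ∩ s ⁻¹' h.domChart.target), fun p => h.domChart.symm (s p),
    hU₀.inter (hs.continuousOn.isOpen_inter_preimage h.codChart.open_source
      h.domChart.open_target), ⟨?_, hmem q₀ h.mem_domChart_source⟩, ?_, ?_⟩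
  · have := h.mem_domChart_source
    rwa [← hU₀'] at this
  · have h1 := contMDiffOn_symm_of_mem_maximalAtlas h.domChart_mem_maximalAtlas
    exact h1.comp (hs.mono fun p hp => hp.2.1) fun p hp => hp.2.2
  · intro c hc
    have hc' : c ∈ h.domChart.source := by
      rw [← hU₀']
      exact hc.1
    simp only [key c hc', h.domChart.left_inv hc']

/-- Chain rule for `r ∘ ι = id` near `c`. The value is read in `F` because its base point `r (ι c)`
is only propositionally equal to `c`. -/
theorem IsSmoothEmbedding.mfderiv_retraction (hι : IsSmoothEmbedding 𝓘(ℝ, F) 𝓘(ℝ, E) ∞ ι)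
    {U : Set P} {r : P → C} (hU : IsOpen U) (hr : ContMDiffOn 𝓘(ℝ, E) 𝓘(ℝ, F) ∞ r U)
    (hrι : ∀ c, ι c ∈ U → r (ι c) = c) {c : C} (hc : ι c ∈ U) (v : TangentSpace 𝓘(ℝ, F) c) :
    (mfderiv 𝓘(ℝ, E) 𝓘(ℝ, F) r (ι c) (mfderiv 𝓘(ℝ, F) 𝓘(ℝ, E) ι c v) : F) = v := by
  have h1 : MDifferentiableAt 𝓘(ℝ, E) 𝓘(ℝ, F) r (ι c) :=
    (hr.contMDiffAt (hU.mem_nhds hc)).mdifferentiableAt (by simp)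
  have h2 : MDifferentiableAt 𝓘(ℝ, F) 𝓘(ℝ, E) ι c := hι.contMDiff.mdifferentiableAt (by simp)
  have h3 : r ∘ ι =ᶠ[𝓝 c] id := by
    filter_upwards [hι.contMDiff.continuous.continuousAt.preimage_mem_nhds (hU.mem_nhds hc)]
      with c' hc' using hrι c' hc'
  have h4 := h3.mfderiv_eq (I := 𝓘(ℝ, F)) (I' := 𝓘(ℝ, F))
  rw [mfderiv_comp c h1 h2, mfderiv_id] at h4
  exact congrArg (fun L : F →L[ℝ] F => L v) h4

/-- The derivative of a local retraction is a left inverse. -/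
theorem IsSmoothEmbedding.mfderiv_injective (hι : IsSmoothEmbedding 𝓘(ℝ, F) 𝓘(ℝ, E) ∞ ι)
    (c : C) : Function.Injective (mfderiv 𝓘(ℝ, F) 𝓘(ℝ, E) ι c) := by
  obtain ⟨U, r, hU, hc, hr, hrι⟩ := exists_local_retraction hι c
  exact Function.LeftInverse.injective
    (g := fun W => (mfderiv 𝓘(ℝ, E) 𝓘(ℝ, F) r (ι c) W : F))
    fun v => IsSmoothEmbedding.mfderiv_retraction hι hU hr hrι hc v

end Embedding

/-! ### Tangent vectors in a fixed chart. -/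

section Coordinates

variable {E : Type*} [NormedAddCommGroup E] [NormedSpace ℝ E]
  {P : Type*} [TopologicalSpace P] [ChartedSpace E P] [IsManifold 𝓘(ℝ, E) ∞ P]
  {F : Type*} [NormedAddCommGroup F] [NormedSpace ℝ F]
  {C : Type*} [TopologicalSpace C] [ChartedSpace F C]

/-- The components of tangent vectors at `p` in the preferred chart at `p₀`. -/
def toCoord (p₀ p : P) : TangentSpace 𝓘(ℝ, E) p →L[ℝ] E :=
  (trivializationAt E (TangentSpace 𝓘(ℝ, E)) p₀).continuousLinearMapAt ℝ p

/-- The tangent vectors at `p` with given components in the preferred chart at `p₀`. -/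
def ofCoord (p₀ p : P) : E →L[ℝ] TangentSpace 𝓘(ℝ, E) p :=
  (trivializationAt E (TangentSpace 𝓘(ℝ, E)) p₀).symmL ℝ p

variable {p₀ p : P}

theorem toCoord_ofCoord (hp : p ∈ (chartAt E p₀).source) (v : E) :
    toCoord p₀ p (ofCoord p₀ p v) = v :=
  (trivializationAt E (TangentSpace 𝓘(ℝ, E)) p₀).continuousLinearMapAt_symmL hp v

theorem ofCoord_toCoord (hp : p ∈ (chartAt E p₀).source) (V : TangentSpace 𝓘(ℝ, E) p) :
    ofCoord p₀ p (toCoord p₀ p V) = V :=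
  (trivializationAt E (TangentSpace 𝓘(ℝ, E)) p₀).symmL_continuousLinearMapAt hp V

theorem toCoord_eq_mfderiv (hp : p ∈ (chartAt E p₀).source) :
    toCoord p₀ p = mfderiv 𝓘(ℝ, E) 𝓘(ℝ, E) (extChartAt 𝓘(ℝ, E) p₀) p :=
  TangentBundle.continuousLinearMapAt_trivializationAt hp

theorem ofCoord_eq_mfderiv (hp : p ∈ (chartAt E p₀).source) :
    ofCoord (E := E) p₀ p = mfderiv 𝓘(ℝ, E) 𝓘(ℝ, E) (extChartAt 𝓘(ℝ, E) p₀).symm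
      (extChartAt 𝓘(ℝ, E) p₀ p) := by
  have := TangentBundle.symmL_trivializationAt (I := 𝓘(ℝ, E)) hp
  rw [ModelWithCorners.range_eq_univ, mfderivWithin_univ] at this
  exact this

/-- Smoothness of vector fields along a map, in coordinates. -/
theorem contMDiffAt_iff_toCoord {g : C → P} {X : ∀ c, TangentSpace 𝓘(ℝ, E) (g c)} {c : C}
    (hg : ContMDiffAt 𝓘(ℝ, F) 𝓘(ℝ, E) ∞ g c) (hc : g c ∈ (chartAt E p₀).source) :
    ContMDiffAt 𝓘(ℝ, F) 𝓘(ℝ, E).tangent ∞ (fun c => (⟨g c, X c⟩ : TangentBundle 𝓘(ℝ, E) P)) c ↔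
      ContMDiffAt 𝓘(ℝ, F) 𝓘(ℝ, E) ∞ (fun c => toCoord p₀ (g c) (X c)) c := by
  rw [(trivializationAt E (TangentSpace 𝓘(ℝ, E)) p₀).contMDiffAt_iff (f := fun c =>
    (⟨g c, X c⟩ : TangentBundle 𝓘(ℝ, E) P))
    ((trivializationAt E (TangentSpace 𝓘(ℝ, E)) p₀).mem_source.2 hc)]
  simp only [hg, true_and]
  refine Filter.EventuallyEq.contMDiffAt_iff ?_
  filter_upwards [hg.continuousAt.preimage_mem_nhds ((chartAt E p₀).open_source.mem_nhds hc)]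
    with c' hc'
  exact ((trivializationAt E (TangentSpace 𝓘(ℝ, E)) p₀).continuousLinearMapAt_apply_of_mem
    ℝ hc' _).symm

theorem contMDiffAt_ofCoord {g : C → P} {v : C → E} {c : C}
    (hg : ContMDiffAt 𝓘(ℝ, F) 𝓘(ℝ, E) ∞ g c) (hc : g c ∈ (chartAt E p₀).source)
    (hv : ContMDiffAt 𝓘(ℝ, F) 𝓘(ℝ, E) ∞ v c) :
    ContMDiffAt 𝓘(ℝ, F) 𝓘(ℝ, E).tangent ∞
      (fun c => (⟨g c, ofCoord p₀ (g c) (v c)⟩ : TangentBundle 𝓘(ℝ, E) P)) c := by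
  rw [contMDiffAt_iff_toCoord hg hc]
  refine hv.congr_of_eventuallyEq ?_
  filter_upwards [hg.continuousAt.preimage_mem_nhds ((chartAt E p₀).open_source.mem_nhds hc)]
    with c' hc' using toCoord_ofCoord hc' _

end Coordinates

/-! ### The presymplectic form in coordinates. -/

section TwoForm

variable {E : Type*} [NormedAddCommGroup E] [NormedSpace ℝ E]
  {P : Type*} [TopologicalSpace P] [ChartedSpace E P]

variable (E) in
/-- A 2-form on a vector space as a bilinear map. -/
def twoFormCurry : E [⋀^Fin 2]→L[ℝ] ℝ →L[ℝ] E →L[ℝ] E →L[ℝ] ℝ :=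
  (ContinuousLinearMap.compL ℝ E _ _
      (continuousMultilinearCurryFin1 ℝ E ℝ).toContinuousLinearEquiv.toContinuousLinearMap) ∘L
    (continuousMultilinearCurryLeftEquiv ℝ
      (fun _ : Fin 2 => E) ℝ).toContinuousLinearEquiv.toContinuousLinearMap ∘L
    ContinuousAlternatingMap.toContinuousMultilinearMapCLM ℝ

theorem twoFormCurry_apply (η : E [⋀^Fin 2]→L[ℝ] ℝ) (v w : E) :
    twoFormCurry E η v w = η ![v, w] := by
  simp [twoFormCurry]

/-- The components of a presymplectic form at `p` in the preferred chart at `p₀`. -/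
def PresymplecticForm.coordForm (Ω : PresymplecticForm E P) (p₀ p : P) : E →L[ℝ] E →L[ℝ] ℝ :=
  twoFormCurry E (Ω.form.inChart p₀ (extChartAt 𝓘(ℝ, E) p₀ p))

theorem TwoForm.inChart_apply (η : TwoForm E P) (p₀ p : P) (y : E)
    (hy : (extChartAt 𝓘(ℝ, E) p₀).symm y = p) (v w : E) :
    η.inChart p₀ y ![v, w] = η p ![mfderiv 𝓘(ℝ, E) 𝓘(ℝ, E) (extChartAt 𝓘(ℝ, E) p₀).symm y v,
      mfderiv 𝓘(ℝ, E) 𝓘(ℝ, E) (extChartAt 𝓘(ℝ, E) p₀).symm y w] := by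
  subst hy
  refine congrArg (η ((extChartAt 𝓘(ℝ, E) p₀).symm y)) (funext fun i => ?_)
  fin_cases i <;> rfl

variable [IsManifold 𝓘(ℝ, E) ∞ P]

theorem PresymplecticForm.coordForm_apply (Ω : PresymplecticForm E P) {p₀ p : P}
    (hp : p ∈ (chartAt E p₀).source) (v w : E) :
    Ω.coordForm p₀ p v w = Ω.form p ![ofCoord p₀ p v, ofCoord p₀ p w] := by
  rw [PresymplecticForm.coordForm, twoFormCurry_apply,
    TwoForm.inChart_apply _ _ p _ ((extChartAt 𝓘(ℝ, E) p₀).left_inv (by simpa using hp)), ofCoord_eq_mfderiv hp]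
  rfl

theorem PresymplecticForm.contMDiffOn_coordForm (Ω : PresymplecticForm E P) (p₀ : P) :
    ContMDiffOn 𝓘(ℝ, E) 𝓘(ℝ, E →L[ℝ] E →L[ℝ] ℝ) ∞ (Ω.coordForm p₀) (chartAt E p₀).source := by
  have h := (Ω.smooth p₀).contMDiffOn.comp (contMDiffOn_extChartAt (I := 𝓘(ℝ, E)) (x := p₀))
    fun p hp => (extChartAt 𝓘(ℝ, E) p₀).map_source (by simpa using hp)
  have h' : ContDiff ℝ ∞ (twoFormCurry E) := ContinuousLinearMap.contDiff (𝕜 := ℝ)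
    (E := E [⋀^Fin 2]→L[ℝ] ℝ) (F := E →L[ℝ] E →L[ℝ] ℝ) (twoFormCurry E)
  exact h'.contMDiff.comp_contMDiffOn h

end TwoForm

/-! ### Smoothness of fields and differentials in coordinates. -/

section Fields

variable {E : Type*} [NormedAddCommGroup E] [NormedSpace ℝ E]
  {P : Type*} [TopologicalSpace P] [ChartedSpace E P] [IsManifold 𝓘(ℝ, E) ∞ P]
  {F : Type*} [NormedAddCommGroup F] [NormedSpace ℝ F]
  {C : Type*} [TopologicalSpace C] [ChartedSpace F C]
  {ι : C → P}

/-- A vector field along a map that is given in coordinates, multiplied by a cut-off function. -/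
theorem contMDiff_smul_ofCoord {g : C → P} (hg : ContMDiff 𝓘(ℝ, F) 𝓘(ℝ, E) ∞ g) {p₀ : P}
    {ρ : C → ℝ} (hρ : ContMDiff 𝓘(ℝ, F) 𝓘(ℝ, ℝ) ∞ ρ) {v : C → E}
    (h : ∀ c ∈ tsupport ρ, g c ∈ (chartAt E p₀).source ∧ ContMDiffAt 𝓘(ℝ, F) 𝓘(ℝ, E) ∞ v c) :
    ContMDiff 𝓘(ℝ, F) 𝓘(ℝ, E).tangent ∞
      (fun c => (⟨g c, ρ c • ofCoord p₀ (g c) (v c)⟩ : TangentBundle 𝓘(ℝ, E) P)) := by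
  intro c
  by_cases hc : c ∈ tsupport ρ
  · have h1 := contMDiffAt_ofCoord hg.contMDiffAt (h c hc).1
      (hρ.contMDiffAt.smul (h c hc).2)
    refine h1.congr_of_eventuallyEq (Eventually.of_forall fun c' => ?_)
    simp
  -- Off the support `g c` may leave the chart at `p₀`, so the locally zero field is tested in the
  -- chart at `g c`.
  · rw [contMDiffAt_iff_toCoord (p₀ := g c) hg.contMDiffAt (mem_chart_source E _)]
    refine (contMDiffAt_const (c := (0 : E))).congr_of_eventuallyEq ?_
    filter_upwards [notMem_tsupport_iff_eventuallyEq.1 hc] with c' hc'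
    simp [hc']

variable [IsManifold 𝓘(ℝ, F) ∞ C]

/-- The push-forward of a smooth vector field is smooth. -/
theorem contMDiffAt_pushField (hι : ContMDiff 𝓘(ℝ, F) 𝓘(ℝ, E) ∞ ι)
    {Y : ∀ c : C, TangentSpace 𝓘(ℝ, F) c} {c : C}
    (hY : ContMDiffAt 𝓘(ℝ, F) 𝓘(ℝ, F).tangent ∞
      (fun c => (⟨c, Y c⟩ : TangentBundle 𝓘(ℝ, F) C)) c) :
    ContMDiffAt 𝓘(ℝ, F) 𝓘(ℝ, E).tangent ∞
      (fun c => (⟨ι c, pushField ι Y c⟩ : TangentBundle 𝓘(ℝ, E) P)) c :=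
  (hι.contMDiff_tangentMap (m := ∞) le_rfl).contMDiffAt.comp c hY

/-- The differential of a smooth function, in coordinates, is smooth. -/
theorem contMDiffAt_mvfderiv_ofCoord [FiniteDimensional ℝ E] {f : P → ℝ}
    (hf : ContMDiff 𝓘(ℝ, E) 𝓘(ℝ, ℝ) ∞ f) {p₀ p : P} (hp : p ∈ (chartAt E p₀).source) :
    ContMDiffAt 𝓘(ℝ, E) 𝓘(ℝ, E →L[ℝ] ℝ) ∞
      (fun p => (mvfderiv 𝓘(ℝ, E) f p) ∘L (ofCoord p₀ p)) p := by
  refine contMDiffAt_clm_of_apply fun u => ?_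
  have h := contMDiffAt_pushField (ι := f) hf (contMDiffAt_ofCoord (p₀ := p₀)
    (contMDiffAt_id (x := p)) hp (contMDiffAt_const (c := u)))
  exact (contMDiff_snd_tangentBundle_modelSpace ℝ 𝓘(ℝ, ℝ)).contMDiffAt.comp p h

/-- The derivative of `ι` in the preferred charts at `q₀` and `ι q₀`. -/
def coordDeriv (ι : C → P) (q₀ c : C) : F →L[ℝ] E :=
  toCoord (ι q₀) (ι c) ∘L mfderiv 𝓘(ℝ, F) 𝓘(ℝ, E) ι c ∘L ofCoord q₀ c

theorem contMDiffAt_coordDeriv [FiniteDimensional ℝ F]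
    (hι : ContMDiff 𝓘(ℝ, F) 𝓘(ℝ, E) ∞ ι) {q₀ c : C} (hc : c ∈ (chartAt F q₀).source)
    (hιc : ι c ∈ (chartAt E (ι q₀)).source) :
    ContMDiffAt 𝓘(ℝ, F) 𝓘(ℝ, F →L[ℝ] E) ∞ (coordDeriv (E := E) (F := F) ι q₀) c := by
  refine contMDiffAt_clm_of_apply fun u => ?_
  have h := contMDiffAt_pushField hι (contMDiffAt_ofCoord (p₀ := q₀)
    (contMDiffAt_id (x := c)) hc (contMDiffAt_const (c := u)))
  exact (contMDiffAt_iff_toCoord hι.contMDiffAt hιc).1 h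

end Fields

/-! ### Product rule at a zero. -/

section ProductRule

variable {E : Type*} [NormedAddCommGroup E] [NormedSpace ℝ E]
  {P : Type*} [TopologicalSpace P] [ChartedSpace E P]

/-- The pairing of a smooth covector-valued function with a smooth vector-valued function is
differentiated by the product rule; here at a zero of the latter. -/
theorem mvfderiv_clm_apply_of_eq_zero {a : P → E →L[ℝ] ℝ} {h : P → E} {p : P}
    (ha : MDifferentiableAt 𝓘(ℝ, E) 𝓘(ℝ, E →L[ℝ] ℝ) a p)
    (hh : MDifferentiableAt 𝓘(ℝ, E) 𝓘(ℝ, E) h p) (h0 : h p = 0) (W : TangentSpace 𝓘(ℝ, E) p) :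
    mvfderiv 𝓘(ℝ, E) (fun p => a p (h p)) p W = a p (mvfderiv 𝓘(ℝ, E) h p W) := by
  have h1 : HasMFDerivAt 𝓘(ℝ, E) 𝓘(ℝ, ℝ) (fun p => a p (h p)) p _ :=
    ⟨ha.continuousAt.clm_apply hh.continuousAt, ha.hasMFDerivAt.2.clm_apply hh.hasMFDerivAt.2⟩
  refine (congrArg (fun L : E →L[ℝ] ℝ => L W) h1.mfderiv).trans ?_
  change a ((extChartAt 𝓘(ℝ, E) p).symm (extChartAt 𝓘(ℝ, E) p p))
    (mfderiv 𝓘(ℝ, E) 𝓘(ℝ, E) h p W) + (show E →L[ℝ] ℝ from mfderiv 𝓘(ℝ, E) 𝓘(ℝ, E →L[ℝ] ℝ) a p W)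
      (h ((extChartAt 𝓘(ℝ, E) p).symm (extChartAt 𝓘(ℝ, E) p p))) = _
  rw [extChartAt_to_inv, h0, map_zero, add_zero]
  rfl

end ProductRule

/-! ### Constraints with prescribed differential. -/

section Constraint

variable {E : Type*} [NormedAddCommGroup E] [NormedSpace ℝ E] [FiniteDimensional ℝ E]
  {P : Type*} [TopologicalSpace P] [T2Space P] [ChartedSpace E P] [IsManifold 𝓘(ℝ, E) ∞ P]
  {F : Type*} [NormedAddCommGroup F] [NormedSpace ℝ F]
  {C : Type*} [TopologicalSpace C] [ChartedSpace F C]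
  {ι : C → P}

/-- A smooth family of covectors along an embedded submanifold that kills its tangent vectors is,
up to a cut-off function, the differential of a constraint. -/
theorem exists_constraint (hι : IsSmoothEmbedding 𝓘(ℝ, F) 𝓘(ℝ, E) ∞ ι) (q₀ : C)
    {A : C → E →L[ℝ] ℝ} {N : Set C} (hN : N ∈ 𝓝 q₀)
    (hA : ∀ c ∈ N, ContMDiffAt 𝓘(ℝ, F) 𝓘(ℝ, E →L[ℝ] ℝ) ∞ A c) :
    ∃ (f : P → ℝ) (ρ : C → ℝ), IsConstraint E ι f ∧ ContMDiff 𝓘(ℝ, F) 𝓘(ℝ, ℝ) ∞ ρ ∧ ρ q₀ = 1 ∧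
      tsupport ρ ⊆ N ∧ ∀ c, (ρ c = 0 ∧ mvfderiv 𝓘(ℝ, E) f (ι c) = 0) ∨
        (c ∈ N ∧ ((∀ W ∈ subTangent (E := E) (F := F) ι c, A c (toCoord (ι q₀) (ι c) W) = 0) →
          ∀ W, mvfderiv 𝓘(ℝ, E) f (ι c) W = ρ c * A c (toCoord (ι q₀) (ι c) W))) := by
  obtain ⟨U, r, hU, hqU, hr, hrι⟩ := exists_local_retraction hι q₀
  set χ := extChartAt 𝓘(ℝ, E) (ι q₀)
  obtain ⟨N', hN'N, hN', hqN'⟩ := mem_nhds_iff.1 hN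
  let S := (chartAt E (ι q₀)).source
  have hS : IsOpen S := (chartAt E (ι q₀)).open_source
  have hqS : ι q₀ ∈ S := mem_chart_source E _
  -- On `U'` the retraction is smooth, both `p` and `ι (r p)` lie in the chart, and `r p` lies where
  -- `A` is smooth.
  let U' := S ∩ (U ∩ r ⁻¹' (N' ∩ ι ⁻¹' S))
  have hU' : IsOpen U' := hS.inter (hr.continuousOn.isOpen_inter_preimage hU
    (hN'.inter (hS.preimage hι.contMDiff.continuous)))
  have hqU' : ι q₀ ∈ U' := ⟨hqS, hqU, by simpa [hrι q₀ hqU] using ⟨hqN', hqS⟩⟩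
  obtain ⟨ρ, -, hρ⟩ := (SmoothBumpFunction.nhds_basis_tsupport (I := 𝓘(ℝ, E))
    (ι q₀)).mem_iff.1 (hU'.mem_nhds hqU')
  let h (p : P) : E := χ p - χ (ι (r p))
  let g (p : P) : ℝ := A (r p) (h p)
  have hrU' (p) (hp : p ∈ U') : ContMDiffAt 𝓘(ℝ, E) 𝓘(ℝ, F) ∞ r p :=
    hr.contMDiffAt (hU.mem_nhds hp.2.1)
  have hχS (p) (hp : p ∈ S) : ContMDiffAt 𝓘(ℝ, E) 𝓘(ℝ, E) ∞ χ p := contMDiffAt_extChartAt' hp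
  have hχr (p) (hp : p ∈ U') : ContMDiffAt 𝓘(ℝ, E) 𝓘(ℝ, E) ∞ (χ ∘ ι ∘ r) p :=
    (hχS _ hp.2.2.2).comp p (hι.contMDiff.contMDiffAt.comp p (hrU' p hp))
  have hh (p) (hp : p ∈ U') : ContMDiffAt 𝓘(ℝ, E) 𝓘(ℝ, E) ∞ h p := (hχS p hp.1).sub (hχr p hp)
  have hAr (p) (hp : p ∈ U') : ContMDiffAt 𝓘(ℝ, E) 𝓘(ℝ, E →L[ℝ] ℝ) ∞ (fun p => A (r p)) p :=
    (hA _ (hN'N hp.2.2.1)).comp p (hrU' p hp)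
  have hg (p) (hp : p ∈ U') : ContMDiffAt 𝓘(ℝ, E) 𝓘(ℝ, ℝ) ∞ g p := (hAr p hp).clm_apply (hh p hp)
  have hhι (c) (hc : ι c ∈ U') : h (ι c) = 0 := by simp [h, hrι c hc.2.1]
  have hgι (c) (hc : ι c ∈ U') : g (ι c) = 0 := by simp [g, hhι c hc]
  have hmemN (c) (hc : ι c ∈ U') : c ∈ N := by
    have := hc.2.2.1
    rw [hrι c hc.2.1] at this
    exact hN'N this
  have hzero (p) (hp : p ∉ U') : ρ =ᶠ[𝓝 p] 0 :=
    notMem_tsupport_iff_eventuallyEq.1 fun h => hp (hρ h)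
  refine ⟨fun p => ρ p • g p, fun c => ρ (ι c), ⟨?_, ?_⟩, ?_, ρ.eq_one, ?_, ?_⟩
  · refine contMDiff_of_tsupport fun p hp => ?_
    exact ρ.contMDiffAt.smul (hg p (hρ (tsupport_smul_subset_left _ _ hp)))
  · intro c
    by_cases hc : ι c ∈ U'
    · simp [hgι c hc]
    · simp [(hzero _ hc).self_of_nhds]
  · exact ρ.contMDiff.comp hι.contMDiff
  · exact (tsupport_comp_subset_preimage ρ hι.contMDiff.continuous).trans
      fun c hc => hmemN c (hρ hc)
  · intro c
    by_cases hc : ι c ∈ U'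
    · refine Or.inr ⟨hmemN c hc, fun hT W => ?_⟩
      have hne : (∞ : WithTop ℕ∞) ≠ 0 := by simp
      have h1 := mvfderiv_fun_smul (ρ.contMDiffAt.mdifferentiableAt hne)
        ((hg _ hc).mdifferentiableAt hne)
      have h2 := mvfderiv_clm_apply_of_eq_zero ((hAr _ hc).mdifferentiableAt hne)
        ((hh _ hc).mdifferentiableAt hne) (hhι c hc) W
      obtain ⟨w, hw⟩ : ∃ w : TangentSpace 𝓘(ℝ, F) c,
          w = (mfderiv 𝓘(ℝ, E) 𝓘(ℝ, F) r (ι c) W : F) := ⟨_, rfl⟩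
      -- In coordinates dh(W) = W − dι(dr W); the subtracted vector is tangent to the submanifold,
      -- so `A c` does not see it.
      have h3 : mvfderiv 𝓘(ℝ, E) h (ι c) W = toCoord (ι q₀) (ι c) W -
          toCoord (ι q₀) (ι c) (mfderiv 𝓘(ℝ, F) 𝓘(ℝ, E) ι c w) := by
        have hr' := (hrU' _ hc).mdifferentiableAt hne
        have hι' : MDifferentiableAt 𝓘(ℝ, F) 𝓘(ℝ, E) ι c := hι.contMDiff.mdifferentiableAt hne
        have hχ' := (hχS _ hc.1).mdifferentiableAt hne
        have hk : MDifferentiableAt 𝓘(ℝ, F) 𝓘(ℝ, E) (χ ∘ ι) c := hχ'.comp c hι'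
        have h4 := mvfderiv_sub hχ' ((hχr _ hc).mdifferentiableAt hne)
        have h5 := mfderiv_comp_apply_of_eq (g := χ ∘ ι) (ι c) hk hr' (hrι c hc.2.1) W
        have h6 := mfderiv_comp_apply (g := χ) c hχ' hι' w
        have h7 : mvfderiv 𝓘(ℝ, E) χ (ι c) = toCoord (ι q₀) (ι c) :=
          (toCoord_eq_mfderiv hc.1).symm
        refine (congrArg (fun L : E →L[ℝ] E => L W) h4).trans ?_
        refine congrArg₂ (fun x y : E => x - y) (congrArg (fun L : E →L[ℝ] E => L W) h7) ?_
        refine h5.trans ?_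
        rw [← hw, ← h7]
        exact h6
      have hTw : A c (toCoord (ι q₀) (ι c) (mfderiv 𝓘(ℝ, F) 𝓘(ℝ, E) ι c w)) = 0 := hT _ ⟨w, rfl⟩
      have h4 : A (r (ι c)) (mvfderiv 𝓘(ℝ, E) h (ι c) W) = A c (toCoord (ι q₀) (ι c) W) := by
        rw [hrι c hc.2.1, h3, map_sub]
        exact (congrArg _ hTw).trans (sub_zero _)
      refine (congrArg (fun L : E →L[ℝ] ℝ => L W) h1).trans ?_
      change ρ (ι c) * mvfderiv 𝓘(ℝ, E) g (ι c) W + mvfderiv 𝓘(ℝ, E) ρ (ι c) W * g (ι c) = _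
      rw [hgι c hc, mul_zero, add_zero, ← h4]
      exact congrArg _ h2
    · refine Or.inl ⟨(hzero _ hc).self_of_nhds, ?_⟩
      have h1 : (fun p => ρ p • g p) =ᶠ[𝓝 (ι c)] 0 := by
        filter_upwards [hzero _ hc] with p hp
        simp [hp]
      have h2 := h1.mfderiv_eq (I := 𝓘(ℝ, E)) (I' := 𝓘(ℝ, ℝ))
      exact h2.trans (mvfderiv_zero (I := 𝓘(ℝ, E)) (M := P) (F := ℝ))

end Constraint

/-! ### Hamiltonian vectors and polars in coordinates. -/

section Pointwise

variable {E : Type*} [NormedAddCommGroup E] [NormedSpace ℝ E]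
  {P : Type*} [TopologicalSpace P] [ChartedSpace E P]
  (Ω : PresymplecticForm E P)

theorem PresymplecticForm.form_swap {p : P} (V W : TangentSpace 𝓘(ℝ, E) p) :
    Ω.form p ![V, W] = -Ω.form p ![W, V] := by
  have h := (Ω.form p).toAlternatingMap.map_swap ![W, V] (i := 0) (j := 1) (by simp)
  refine Eq.trans ?_ h
  refine congrArg (Ω.form p) (funext fun i => ?_)
  fin_cases i <;> rfl

theorem PresymplecticForm.coordForm_swap (p₀ p : P) (v w : E) :
    Ω.coordForm p₀ p v w = -Ω.coordForm p₀ p w v := by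
  simp only [PresymplecticForm.coordForm, twoFormCurry_apply]
  have h := (Ω.form.inChart p₀ (extChartAt 𝓘(ℝ, E) p₀ p)).toAlternatingMap.map_swap ![w, v]
    (i := 0) (j := 1) (by simp)
  refine Eq.trans ?_ h
  refine congrArg (Ω.form.inChart p₀ (extChartAt 𝓘(ℝ, E) p₀ p)) (funext fun i => ?_)
  fin_cases i <;> rfl

variable [IsManifold 𝓘(ℝ, E) ∞ P] {p₀ p : P}

/-- The coordinate isomorphism of the tangent space at `p` in the preferred chart at `p₀`. -/
def coordEquiv (hp : p ∈ (chartAt E p₀).source) : TangentSpace 𝓘(ℝ, E) p ≃ₗ[ℝ] E :=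
  LinearEquiv.ofLinearMap (toCoord p₀ p).toLinearMap (ofCoord p₀ p).toLinearMap
    (LinearMap.ext (toCoord_ofCoord hp)) (LinearMap.ext (ofCoord_toCoord hp))

theorem PresymplecticForm.form_eq_coordForm (hp : p ∈ (chartAt E p₀).source)
    (V W : TangentSpace 𝓘(ℝ, E) p) :
    Ω.form p ![V, W] = Ω.coordForm p₀ p (toCoord p₀ p V) (toCoord p₀ p W) := by
  rw [Ω.coordForm_apply hp, ofCoord_toCoord hp, ofCoord_toCoord hp]

theorem PresymplecticForm.isHamiltonianVector_iff (hp : p ∈ (chartAt E p₀).source) (f : P → ℝ)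
    (V : TangentSpace 𝓘(ℝ, E) p) :
    Ω.IsHamiltonianVector f V ↔
      Ω.coordForm p₀ p (toCoord p₀ p V) = mvfderiv 𝓘(ℝ, E) f p ∘L ofCoord p₀ p := by
  constructor
  · intro h
    ext w
    have := h (ofCoord p₀ p w)
    rwa [Ω.form_eq_coordForm hp, toCoord_ofCoord hp] at this
  · intro h W
    rw [Ω.form_eq_coordForm hp, h, ContinuousLinearMap.comp_apply, ofCoord_toCoord hp]

theorem PresymplecticForm.mem_polar_top_iff (hp : p ∈ (chartAt E p₀).source)
    (V : TangentSpace 𝓘(ℝ, E) p) :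
    V ∈ Ω.polar (⊤ : Submodule ℝ (TangentSpace 𝓘(ℝ, E) p)) ↔
      ∀ w : E, Ω.coordForm p₀ p (toCoord p₀ p V) w = 0 := by
  constructor
  · intro h w
    have := h (ofCoord p₀ p w) trivial
    rwa [Ω.form_eq_coordForm hp, toCoord_ofCoord hp] at this
  · intro h W _
    rw [Ω.form_eq_coordForm hp, h]

variable {F : Type*} [NormedAddCommGroup F] [NormedSpace ℝ F]
  {C : Type*} [TopologicalSpace C] [ChartedSpace F C] [IsManifold 𝓘(ℝ, F) ∞ C]
  {ι : C → P} {q₀ c : C}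

theorem ofCoord_coordDeriv (hιc : ι c ∈ (chartAt E (ι q₀)).source) (u : F) :
    ofCoord (ι q₀) (ι c) (coordDeriv (E := E) (F := F) ι q₀ c u) =
      mfderiv 𝓘(ℝ, F) 𝓘(ℝ, E) ι c (ofCoord q₀ c u) :=
  ofCoord_toCoord hιc _

theorem toCoord_mfderiv (hc : c ∈ (chartAt F q₀).source) (Y : TangentSpace 𝓘(ℝ, F) c) :
    toCoord (ι q₀) (ι c) (mfderiv 𝓘(ℝ, F) 𝓘(ℝ, E) ι c Y) =
      coordDeriv (E := E) (F := F) ι q₀ c (toCoord q₀ c Y) := by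
  simp only [coordDeriv, ContinuousLinearMap.comp_apply]
  rw [ofCoord_toCoord hc]

theorem PresymplecticForm.mem_polar_subTangent_iff (hc : c ∈ (chartAt F q₀).source)
    (hιc : ι c ∈ (chartAt E (ι q₀)).source) (V : TangentSpace 𝓘(ℝ, E) (ι c)) :
    V ∈ Ω.polar (subTangent (F := F) ι c) ↔ ∀ u : F, Ω.coordForm (ι q₀) (ι c)
      (toCoord (ι q₀) (ι c) V) (coordDeriv (E := E) (F := F) ι q₀ c u) = 0 := by
  constructor
  · intro h u
    have := h _ ⟨ofCoord q₀ c u, rfl⟩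
    rwa [Ω.form_eq_coordForm hιc] at this
  · rintro h _ ⟨Y, rfl⟩
    rw [Ω.form_eq_coordForm hιc]
    exact (congrArg _ (toCoord_mfderiv hc Y)).trans (h _)

end Pointwise

/-! ### Hamiltonian vectors in the image of a linear map. -/

section Existence

variable {E : Type*} [NormedAddCommGroup E] [NormedSpace ℝ E] [FiniteDimensional ℝ E]
  {P : Type*} [TopologicalSpace P] [ChartedSpace E P] [IsManifold 𝓘(ℝ, E) ∞ P]
  (Ω : PresymplecticForm E P)
  {G : Type*} [NormedAddCommGroup G] [NormedSpace ℝ G]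

/-- If `df` kills the polar of the image of `L`, then `f` has a Hamiltonian vector in it. -/
theorem PresymplecticForm.exists_isHamiltonianVector {p₀ p : P}
    (hp : p ∈ (chartAt E p₀).source) (L : G →L[ℝ] E) {D : Submodule ℝ (TangentSpace 𝓘(ℝ, E) p)}
    (hD : ∀ V, V ∈ D ↔ ∀ u, Ω.coordForm p₀ p (toCoord p₀ p V) (L u) = 0) {f : P → ℝ}
    (hf : DerivVanishesOn f D) : ∃ u, Ω.IsHamiltonianVector f (ofCoord p₀ p (L u)) := by
  have h (v : E) (hv : ∀ u, Ω.coordForm p₀ p (L u) v = 0) : ofCoord p₀ p v ∈ D := by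
    refine (hD _).2 fun u => ?_
    rw [toCoord_ofCoord hp, Ω.coordForm_swap, hv u, neg_zero]
  obtain ⟨u, hu⟩ := exists_eq_of_forall_vanish (Ω.coordForm p₀ p ∘L L).toLinearMap
    (mvfderiv 𝓘(ℝ, E) f p ∘L ofCoord p₀ p) fun v hv => hf _ (h v hv)
  refine ⟨u, (Ω.isHamiltonianVector_iff hp f _).2 ?_⟩
  rw [toCoord_ofCoord hp]
  exact hu

variable {F : Type*} [NormedAddCommGroup F] [NormedSpace ℝ F]
  {C : Type*} [TopologicalSpace C] [ChartedSpace F C] {ι : C → P} [FiniteDimensional ℝ G]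

/-- If `df` kills the polars of the images of a smooth family `L` and these have constant rank,
then `f` has a smooth local field of Hamiltonian vectors in these images. -/
theorem PresymplecticForm.exists_local_hamiltonian (hι : ContMDiff 𝓘(ℝ, F) 𝓘(ℝ, E) ∞ ι)
    (q₀ : C) {L : C → G →L[ℝ] E}
    (hL : ∀ᶠ c in 𝓝 q₀, ContMDiffAt 𝓘(ℝ, F) 𝓘(ℝ, G →L[ℝ] E) ∞ L c)
    {D : ∀ c, Submodule ℝ (TangentSpace 𝓘(ℝ, E) (ι c))}
    (hD : ∀ᶠ c in 𝓝 q₀, ∀ V, V ∈ D c ↔ ∀ u, Ω.coordForm (ι q₀) (ι c)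
      (toCoord (ι q₀) (ι c) V) (L c u) = 0)
    (hrank : HasConstantRankNear ι D q₀) {f : P → ℝ} (hf : ContMDiff 𝓘(ℝ, E) 𝓘(ℝ, ℝ) ∞ f)
    (hfD : ∀ c, DerivVanishesOn f (D c)) :
    ∃ u : C → G, ∀ᶠ c in 𝓝 q₀, ContMDiffAt 𝓘(ℝ, F) 𝓘(ℝ, G) ∞ u c ∧
      Ω.IsHamiltonianVector f (ofCoord (ι q₀) (ι c) (L c (u c))) := by
  have hS : ∀ᶠ c in 𝓝 q₀, ι c ∈ (chartAt E (ι q₀)).source :=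
    hι.continuous.continuousAt.preimage_mem_nhds (chart_source_mem_nhds E _)
  let A (c : C) : G →L[ℝ] E →L[ℝ] ℝ := Ω.coordForm (ι q₀) (ι c) ∘L L c
  have hA : ∀ᶠ c in 𝓝 q₀, ContMDiffAt 𝓘(ℝ, F) 𝓘(ℝ, G →L[ℝ] E →L[ℝ] ℝ) ∞ A c := by
    filter_upwards [hS, hL] with c h1 h2
    exact ContMDiffAt.clm_comp (((Ω.contMDiffOn_coordForm (ι q₀)).contMDiffAt
      ((chartAt E (ι q₀)).open_source.mem_nhds h1)).comp c hι.contMDiffAt) h2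
  -- Up to coordinates `D c` is the common kernel of the forms `A c u`, so constant dimension of `D`
  -- is constant rank of `A`.
  have hsum : ∀ᶠ c in 𝓝 q₀, Module.finrank ℝ (LinearMap.range (A c).toLinearMap) +
      Module.finrank ℝ (D c) = Module.finrank ℝ E := by
    filter_upwards [hS, hD] with c h1 h2
    refine finrank_range_add_finrank_of_forall_mem_iff _ (coordEquiv h1) _ fun V => ?_
    rw [h2]
    refine forall_congr' fun u => ?_
    rw [Ω.coordForm_swap, neg_eq_zero]
    rfl
  obtain ⟨u, h1, h2, -⟩ := exists_local_solution
    (b := fun c => mvfderiv 𝓘(ℝ, E) f (ι c) ∘L ofCoord (ι q₀) (ι c)) hA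
    (hS.mono fun c hc => (contMDiffAt_mvfderiv_ofCoord hf hc).comp c hι.contMDiffAt)
    (by
      filter_upwards [hsum, hrank] with c h1 h2
      have := hsum.self_of_nhds
      omega)
    (by
      filter_upwards [hS, hD] with c h1 h2
      obtain ⟨u, hu⟩ := Ω.exists_isHamiltonianVector h1 (L c) h2 (hfD c)
      rw [Ω.isHamiltonianVector_iff h1, toCoord_ofCoord h1] at hu
      exact ⟨u, hu⟩)
  refine ⟨u, ?_⟩
  filter_upwards [hS, h1, h2] with c hc h1 h2
  refine ⟨h1, (Ω.isHamiltonianVector_iff hc f _).2 ?_⟩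
  rw [toCoord_ofCoord hc]
  exact h2

end Existence

/-! ### Gluing by partitions of unity. -/

section Globalization

variable {E : Type*} [NormedAddCommGroup E] [NormedSpace ℝ E]
  {P : Type*} [TopologicalSpace P] [ChartedSpace E P] [IsManifold 𝓘(ℝ, E) ∞ P]
  {F : Type*} [NormedAddCommGroup F] [NormedSpace ℝ F]
  {C : Type*} [TopologicalSpace C] [ChartedSpace F C]

open Bundle in
/-- A section of a pulled back tangent bundle is smooth iff it is smooth as a vector field along
the map. -/
theorem contMDiffAt_pullback_tangent_iff (Φ : ContMDiffMap 𝓘(ℝ, F) 𝓘(ℝ, E) C P ∞)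
    {X : ∀ c, TangentSpace 𝓘(ℝ, E) (Φ c)} {c : C} :
    ContMDiffAt 𝓘(ℝ, F) (𝓘(ℝ, F).prod 𝓘(ℝ, E)) ∞
      (fun c => TotalSpace.mk' (E := Φ *ᵖ (TangentSpace 𝓘(ℝ, E) : P → Type _)) E c (X c)) c ↔
    ContMDiffAt 𝓘(ℝ, F) 𝓘(ℝ, E).tangent ∞
      (fun c => (⟨Φ c, X c⟩ : TangentBundle 𝓘(ℝ, E) P)) c := by
  refine (contMDiffAt_section (IB := 𝓘(ℝ, F)) (F := E)
    (E := Φ *ᵖ (TangentSpace 𝓘(ℝ, E) : P → Type _)) (s := X) c).trans ?_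
  refine Iff.trans ?_ (contMDiffAt_totalSpace (IM := 𝓘(ℝ, F)) (IB := 𝓘(ℝ, E)) (F := E)
    (E := (TangentSpace 𝓘(ℝ, E) : P → Type _)) (f := fun c => ⟨Φ c, X c⟩) (x₀ := c)).symm
  exact ⟨fun h => ⟨Φ.contMDiff.contMDiffAt, h⟩, fun h => h.2⟩

/-- Smooth vector fields along a map with values in given convex sets exist globally if they exist
locally. -/
theorem exists_field_forall_mem_convex [FiniteDimensional ℝ F] [T2Space C] [SigmaCompactSpace C]
    [IsManifold 𝓘(ℝ, F) ∞ C] {g : C → P} (hg : ContMDiff 𝓘(ℝ, F) 𝓘(ℝ, E) ∞ g)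
    (t : ∀ c, Set (TangentSpace 𝓘(ℝ, E) (g c))) (ht : ∀ c, Convex ℝ (t c))
    (hloc : ∀ q, ∃ X : ∀ c, TangentSpace 𝓘(ℝ, E) (g c), ∀ᶠ c in 𝓝 q,
      ContMDiffAt 𝓘(ℝ, F) 𝓘(ℝ, E).tangent ∞
        (fun c => (⟨g c, X c⟩ : TangentBundle 𝓘(ℝ, E) P)) c ∧ X c ∈ t c) :
    ∃ X : ∀ c, TangentSpace 𝓘(ℝ, E) (g c), ContMDiff 𝓘(ℝ, F) 𝓘(ℝ, E).tangent ∞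
      (fun c => (⟨g c, X c⟩ : TangentBundle 𝓘(ℝ, E) P)) ∧ ∀ c, X c ∈ t c := by
  -- Fields along `g` are sections of the pulled back tangent bundle, where the convex gluing
  -- theorem applies.
  let Φ : ContMDiffMap 𝓘(ℝ, F) 𝓘(ℝ, E) C P ∞ := ⟨g, hg⟩
  let (c : C) : AddCommGroup (Bundle.Pullback Φ (TangentSpace 𝓘(ℝ, E) : P → Type _) c) :=
    inferInstanceAs (AddCommGroup (TangentSpace 𝓘(ℝ, E) (Φ c)))
  obtain ⟨s, hs⟩ := exists_contMDiffSection_forall_mem_convex_of_local (n := ⊤) 𝓘(ℝ, F)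
    (F_fiber := E) (Bundle.Pullback Φ (TangentSpace 𝓘(ℝ, E) : P → Type _)) t ht fun q => by
      obtain ⟨X, hX⟩ := hloc q
      exact ⟨_, hX, X, fun c hc =>
        ((contMDiffAt_pullback_tangent_iff Φ).2 hc.1).contMDiffWithinAt, fun c hc => hc.2⟩
  exact ⟨fun c => s c, fun c => (contMDiffAt_pullback_tangent_iff Φ).1 s.contMDiff.contMDiffAt, hs⟩

end Globalization

/-! ### Hamiltonian vectors of constraints. -/

section Main

variable {E : Type*} [NormedAddCommGroup E] [NormedSpace ℝ E]
  {P : Type*} [TopologicalSpace P] [ChartedSpace E P]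
  (Ω : PresymplecticForm E P)
  {F : Type*} [NormedAddCommGroup F] [NormedSpace ℝ F]
  {C : Type*} [TopologicalSpace C] [ChartedSpace F C]
  {ι : C → P}

/-- Chain rule for `f ∘ ι = 0`. -/
theorem IsConstraint.mvfderiv_mfderiv {f : P → ℝ} (hf : IsConstraint E ι f)
    (hι : ContMDiff 𝓘(ℝ, F) 𝓘(ℝ, E) ∞ ι) (c : C) (Y : TangentSpace 𝓘(ℝ, F) c) :
    mvfderiv 𝓘(ℝ, E) f (ι c) (mfderiv 𝓘(ℝ, F) 𝓘(ℝ, E) ι c Y) = 0 := by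
  have hne : (∞ : WithTop ℕ∞) ≠ 0 := by simp
  have h1 := mvfderiv_comp_apply (g := f) c (hf.smooth.mdifferentiableAt hne)
    (hι.mdifferentiableAt hne) Y
  have h2 : f ∘ ι = fun _ => 0 := funext hf.vanishes
  rw [← h1, h2, mvfderiv_const]
  rfl

/-- On a tangent vector of the submanifold, i_V ω equals df, which vanishes there. This gives the
polar half of the upper bounds for the spans. -/
theorem PresymplecticForm.IsHamiltonianVector.mem_polar {f : P → ℝ} (hf : IsConstraint E ι f)
    (hι : ContMDiff 𝓘(ℝ, F) 𝓘(ℝ, E) ∞ ι) {c : C} {V : TangentSpace 𝓘(ℝ, E) (ι c)}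
    (hV : Ω.IsHamiltonianVector f V) : V ∈ Ω.polar (subTangent (F := F) ι c) := by
  rintro _ ⟨Y, rfl⟩
  exact (hV _).trans (hf.mvfderiv_mfderiv hι c Y)

/-- Antisymmetry: df(V') = ω(V, V') = −ω(V', V) = 0. With `W = ⊤` this is necessity in (i); with `W`
tangent to the submanifold it yields first class. -/
theorem PresymplecticForm.IsHamiltonianVector.derivVanishesOn {f : P → ℝ} {p : P}
    {V : TangentSpace 𝓘(ℝ, E) p} (hV : Ω.IsHamiltonianVector f V)
    {W : Submodule ℝ (TangentSpace 𝓘(ℝ, E) p)} (hW : V ∈ W) :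
    DerivVanishesOn f (Ω.polar W) := by
  intro V' hV'
  rw [← hV V', Ω.form_swap, hV' V hW, neg_zero]

theorem coord_sources_mem_nhds (hι : ContMDiff 𝓘(ℝ, F) 𝓘(ℝ, E) ∞ ι) (q₀ : C) :
    ∀ᶠ c in 𝓝 q₀, c ∈ (chartAt F q₀).source ∧ ι c ∈ (chartAt E (ι q₀)).source :=
  Eventually.and (chart_source_mem_nhds F q₀)
    (hι.continuous.continuousAt.preimage_mem_nhds (chart_source_mem_nhds E _))

variable [IsManifold 𝓘(ℝ, E) ∞ P]

/-- The equation i_V ω = df is affine in V; convexity is what gluing requires. -/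
theorem PresymplecticForm.convex_isHamiltonianVector (f : P → ℝ) (p : P) :
    Convex ℝ {V : TangentSpace 𝓘(ℝ, E) p | Ω.IsHamiltonianVector f V} := by
  intro V hV W hW a b _ _ hab
  have hp := mem_chart_source E p
  simp only [mem_ofPred_eq] at hV hW ⊢
  rw [Ω.isHamiltonianVector_iff hp] at hV hW ⊢
  rw [map_add, map_smul, map_smul, map_add, map_smul, map_smul, hV, hW, ← add_smul, hab, one_smul]

/-- A vector of the polar is a Hamiltonian vector of a constraint. -/
theorem PresymplecticForm.exists_constraint_of_mem_polar [FiniteDimensional ℝ E] [T2Space P]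
    (hι : IsSmoothEmbedding 𝓘(ℝ, F) 𝓘(ℝ, E) ∞ ι) {q₀ : C} {V : TangentSpace 𝓘(ℝ, E) (ι q₀)}
    (hV : V ∈ Ω.polar (subTangent (F := F) ι q₀)) :
    ∃ f, IsConstraint E ι f ∧ Ω.IsHamiltonianVector f V := by
  have hq := mem_chart_source E (ι q₀)
  -- A constant covector suffices: it need only kill the tangent space at `q₀`, the one point where
  -- df is used.
  obtain ⟨f, ρ, hf, -, hρ, -, h⟩ := exists_constraint hι q₀
    (A := fun _ => Ω.coordForm (ι q₀) (ι q₀) (toCoord (ι q₀) (ι q₀) V)) univ_mem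
    fun c _ => contMDiffAt_const
  refine ⟨f, hf, fun W => ?_⟩
  rcases h q₀ with h | h
  · simp [h.1] at hρ
  · rw [h.2 _ W, hρ, one_mul, Ω.form_eq_coordForm hq]
    intro W hW
    rw [← Ω.form_eq_coordForm hq, hV W hW]

/-- A smooth local section of the polars is, up to a cut-off function, a Hamiltonian vector field
of a constraint. -/
theorem PresymplecticForm.exists_constraint_of_local_field [FiniteDimensional ℝ E] [T2Space P]
    (hι : IsSmoothEmbedding 𝓘(ℝ, F) 𝓘(ℝ, E) ∞ ι) {q₀ : C} {v : C → E}
    (hv : ∀ᶠ c in 𝓝 q₀, ContMDiffAt 𝓘(ℝ, F) 𝓘(ℝ, E) ∞ v c)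
    (hvΩ : ∀ᶠ c in 𝓝 q₀, ofCoord (ι q₀) (ι c) (v c) ∈ Ω.polar (subTangent (F := F) ι c))
    {N : Set C} (hN : N ∈ 𝓝 q₀) :
    ∃ (f : P → ℝ) (ρ : C → ℝ), IsConstraint E ι f ∧ ContMDiff 𝓘(ℝ, F) 𝓘(ℝ, ℝ) ∞ ρ ∧ ρ q₀ = 1 ∧
      tsupport ρ ⊆ N ∧
      ∀ c, Ω.IsHamiltonianVector f (ρ c • ofCoord (ι q₀) (ι c) (v c)) := by
  have hN' := inter_mem hN ((coord_sources_mem_nhds hι.contMDiff q₀).and (hv.and hvΩ))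
  obtain ⟨f, ρ, hf, hρ, hρ₀, hρN, h⟩ := exists_constraint hι q₀
    (A := fun c => Ω.coordForm (ι q₀) (ι c) (v c)) hN' fun c hc =>
      ContMDiffAt.clm_apply (((Ω.contMDiffOn_coordForm (ι q₀)).contMDiffAt
      ((chartAt E (ι q₀)).open_source.mem_nhds hc.2.1.2)).comp c hι.contMDiff.contMDiffAt)
        hc.2.2.1
  refine ⟨f, ρ, hf, hρ, hρ₀, hρN.trans inter_subset_left, fun c W => ?_⟩
  rcases h c with h | ⟨⟨-, hc, -, hcΩ⟩, h⟩
  -- Outside the controlled neighbourhood both the cut-off field and df vanish.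
  · rw [h.1, h.2, zero_smul]
    exact (Ω.form (ι c)).map_coord_zero 0 rfl
  · have hform (W) : Ω.form (ι c) ![ofCoord (ι q₀) (ι c) (v c), W] =
        Ω.coordForm (ι q₀) (ι c) (v c) (toCoord (ι q₀) (ι c) W) := by
      rw [Ω.form_eq_coordForm hc.2, toCoord_ofCoord hc.2]
    rw [h (fun W hW => by rw [← hform, hcΩ W hW]) W, (Ω.form (ι c)).vecCons_smul, hform]
    rfl

variable [IsManifold 𝓘(ℝ, F) ∞ C]

/-- The linear map whose kernel is the polar of the tangent space of the submanifold. -/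
def PresymplecticForm.polarMap (Ω : PresymplecticForm E P) (ι : C → P) (q₀ c : C) :
    E →L[ℝ] F →L[ℝ] ℝ :=
  (ContinuousLinearMap.compL ℝ F E ℝ).flip (coordDeriv ι q₀ c) ∘L Ω.coordForm (ι q₀) (ι c)

theorem PresymplecticForm.contMDiffAt_polarMap [FiniteDimensional ℝ F]
    (hι : ContMDiff 𝓘(ℝ, F) 𝓘(ℝ, E) ∞ ι) (q₀ : C) :
    ∀ᶠ c in 𝓝 q₀, ContMDiffAt 𝓘(ℝ, F) 𝓘(ℝ, E →L[ℝ] F →L[ℝ] ℝ) ∞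
      (Ω.polarMap (F := F) ι q₀) c := by
  filter_upwards [coord_sources_mem_nhds hι q₀] with c hc
  refine ContMDiffAt.clm_comp ?_ (((Ω.contMDiffOn_coordForm (ι q₀)).contMDiffAt
      ((chartAt E (ι q₀)).open_source.mem_nhds hc.2)).comp c hι.contMDiffAt)
  have h : ContDiff ℝ ∞ (ContinuousLinearMap.compL ℝ F E ℝ).flip :=
    ContinuousLinearMap.contDiff (𝕜 := ℝ) (E := F →L[ℝ] E) (F := (E →L[ℝ] ℝ) →L[ℝ] F →L[ℝ] ℝ) _
  exact h.contMDiff.contMDiffAt.comp c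
    (contMDiffAt_coordDeriv hι hc.1 hc.2)

theorem PresymplecticForm.mem_polar_iff_polarMap {q₀ c : C} (hc : c ∈ (chartAt F q₀).source)
    (hιc : ι c ∈ (chartAt E (ι q₀)).source) (V : TangentSpace 𝓘(ℝ, E) (ι c)) :
    V ∈ Ω.polar (subTangent (F := F) ι c) ↔
      Ω.polarMap (F := F) ι q₀ c (toCoord (ι q₀) (ι c) V) = 0 := by
  rw [Ω.mem_polar_subTangent_iff hc hιc, ContinuousLinearMap.ext_iff]
  rfl

end Main

/-! ### Hamiltonian fields along and on the submanifold. -/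

section Fields

variable {E : Type*} [NormedAddCommGroup E] [NormedSpace ℝ E] [FiniteDimensional ℝ E]
  {P : Type*} [TopologicalSpace P]
  [ChartedSpace E P] [IsManifold 𝓘(ℝ, E) ∞ P]
  (Ω : PresymplecticForm E P)
  {F : Type*} [NormedAddCommGroup F] [NormedSpace ℝ F] [FiniteDimensional ℝ F]
  {C : Type*} [TopologicalSpace C] [ChartedSpace F C] [IsManifold 𝓘(ℝ, F) ∞ C]
  {ι : C → P}

/-- Hamiltonian vector fields along the submanifold where the characteristic distribution
is regular. -/
theorem PresymplecticForm.exists_hamiltonianField [T2Space C] [SigmaCompactSpace C]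
    (hι : ContMDiff 𝓘(ℝ, F) 𝓘(ℝ, E) ∞ ι) {f : P → ℝ} (hf : ContMDiff 𝓘(ℝ, E) 𝓘(ℝ, ℝ) ∞ f)
    (hrank : ∀ q : C, HasConstantRankNear ι
      (fun q' => Ω.polar (⊤ : Submodule ℝ (TangentSpace 𝓘(ℝ, E) (ι q')))) q)
    (hfΩ : ∀ q : C, DerivVanishesOn f
      (Ω.polar (⊤ : Submodule ℝ (TangentSpace 𝓘(ℝ, E) (ι q))))) :
    ∃ X, Ω.IsHamiltonianFieldAlong F ι f X := by
  obtain ⟨X, h1, h2⟩ := exists_field_forall_mem_convex hι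
    (fun c => {V : TangentSpace 𝓘(ℝ, E) (ι c) | Ω.IsHamiltonianVector f V})
    (fun c => Ω.convex_isHamiltonianVector f _) fun q => by
      obtain ⟨u, hu⟩ := Ω.exists_local_hamiltonian hι q
        (L := fun _ => ContinuousLinearMap.id ℝ E)
        (Eventually.of_forall fun c => contMDiffAt_const)
        ((coord_sources_mem_nhds hι q).mono fun c hc V => Ω.mem_polar_top_iff hc.2 V)
        (hrank q) hf hfΩ
      refine ⟨fun c => ofCoord (ι q) (ι c) (u c), ?_⟩
      filter_upwards [hu, coord_sources_mem_nhds hι q] with c h1 h2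
      exact ⟨contMDiffAt_ofCoord hι.contMDiffAt h2.2 h1.1, h1.2⟩
  exact ⟨X, h1, h2⟩

/-- Tangent Hamiltonian vector fields of first class functions where the polar of the
submanifold is regular. -/
theorem PresymplecticForm.exists_tangent_hamiltonianField [T2Space C] [SigmaCompactSpace C]
    (hι : ContMDiff 𝓘(ℝ, F) 𝓘(ℝ, E) ∞ ι) {f : P → ℝ} (hf : ContMDiff 𝓘(ℝ, E) 𝓘(ℝ, ℝ) ∞ f)
    (hrank : ∀ q : C, HasConstantRankNear ι (fun q' => Ω.polar (subTangent (F := F) ι q')) q)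
    (hfΩ : ∀ q : C, DerivVanishesOn f (Ω.polar (subTangent (F := F) ι q))) :
    ∃ Y : ∀ q : C, TangentSpace 𝓘(ℝ, F) q, IsSmoothField Y ∧
      Ω.IsHamiltonianFieldAlong F ι f (pushField ι Y) := by
  -- Gluing takes place in TC rather than along `ι`, which keeps the field tangent and smooth on
  -- `C`.
  obtain ⟨Y, h1, h2⟩ := exists_field_forall_mem_convex (contMDiff_id (M := C) (I := 𝓘(ℝ, F)))
    (fun c => {Y : TangentSpace 𝓘(ℝ, F) c |
      Ω.IsHamiltonianVector f (mfderiv 𝓘(ℝ, F) 𝓘(ℝ, E) ι c Y)})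
    (fun c => (Ω.convex_isHamiltonianVector f (ι c)).linear_preimage
      (mfderiv 𝓘(ℝ, F) 𝓘(ℝ, E) ι c).toLinearMap) fun q => by
      obtain ⟨u, hu⟩ := Ω.exists_local_hamiltonian hι q (L := coordDeriv ι q)
        ((coord_sources_mem_nhds hι q).mono fun c hc => contMDiffAt_coordDeriv hι hc.1 hc.2)
        ((coord_sources_mem_nhds hι q).mono fun c hc V =>
          Ω.mem_polar_subTangent_iff hc.1 hc.2 V) (hrank q) hf hfΩ
      refine ⟨fun c => ofCoord q c (u c), ?_⟩
      filter_upwards [hu, coord_sources_mem_nhds hι q] with c h1 h2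
      refine ⟨contMDiffAt_ofCoord contMDiffAt_id h2.1 h1.1, ?_⟩
      have h3 := h1.2
      rwa [ofCoord_coordDeriv h2.2] at h3
  exact ⟨Y, h1, fun q => contMDiffAt_pushField hι (h1 q), h2⟩

variable [T2Space P]

/-- Where the polar of the submanifold is regular, its vectors are values of Hamiltonian vector
fields of constraints. -/
theorem PresymplecticForm.exists_hamiltonianField_of_mem_polar
    (hι : IsSmoothEmbedding 𝓘(ℝ, F) 𝓘(ℝ, E) ∞ ι) {q : C}
    (hrank : HasConstantRankNear ι (fun q' => Ω.polar (subTangent (F := F) ι q')) q)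
    {V : TangentSpace 𝓘(ℝ, E) (ι q)} (hV : V ∈ Ω.polar (subTangent (F := F) ι q)) :
    ∃ f X, IsConstraint E ι f ∧ Ω.IsHamiltonianFieldAlong F ι f X ∧ X q = V := by
  have hsrc := coord_sources_mem_nhds hι.contMDiff q
  have hq := hsrc.self_of_nhds
  have hker {c : C} (hc : c ∈ (chartAt F q).source ∧ ι c ∈ (chartAt E (ι q)).source) :
      Module.finrank ℝ (LinearMap.ker (Ω.polarMap (F := F) ι q c).toLinearMap) =
        Module.finrank ℝ (Ω.polar (subTangent (F := F) ι c)) := by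
    have hmap : LinearMap.ker (Ω.polarMap (F := F) ι q c).toLinearMap =
        (Ω.polar (subTangent (F := F) ι c)).map (coordEquiv hc.2).toLinearMap := by
      ext v
      obtain ⟨W, rfl⟩ := (coordEquiv hc.2).surjective v
      have : coordEquiv hc.2 W ∈ (Ω.polar (subTangent (F := F) ι c)).map
          (coordEquiv hc.2).toLinearMap ↔ W ∈ Ω.polar (subTangent (F := F) ι c) := by simp
      rw [this, Ω.mem_polar_iff_polarMap hc.1 hc.2]
      rfl
    rw [hmap]
    exact LinearEquiv.finrank_map_eq (coordEquiv hc.2) _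
  obtain ⟨v, hv, hv0, hvq⟩ := exists_local_kernel_section
    (Ω.contMDiffAt_polarMap (F := F) hι.contMDiff q)
    (by
      filter_upwards [hsrc, hrank] with c h1 h2
      rw [hker h1, hker hq, h2])
    ((Ω.mem_polar_iff_polarMap hq.1 hq.2 V).1 hV)
  obtain ⟨f, ρ, hf, hρ, hρq, hρN, h⟩ := Ω.exists_constraint_of_local_field hι hv
    (by
      filter_upwards [hsrc, hv0] with c h1 h2
      rw [Ω.mem_polar_iff_polarMap h1.1 h1.2, toCoord_ofCoord h1.2, h2]) (hsrc.and hv)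
  refine ⟨f, fun c => ρ c • ofCoord (ι q) (ι c) (v c), hf,
    ⟨contMDiff_smul_ofCoord hι.contMDiff hρ fun c hc => ⟨(hρN hc).1.2, (hρN hc).2⟩, h⟩, ?_⟩
  change ρ q • ofCoord (ι q) (ι q) (v q) = V
  rw [hρq, one_smul, hvq, ofCoord_toCoord hq.2]

/-- Where the tangent part of the polar of the submanifold is regular, its vectors are values of
tangent Hamiltonian vector fields of first class constraints. -/
theorem PresymplecticForm.exists_tangent_hamiltonianField_of_mem_inf
    (hι : IsSmoothEmbedding 𝓘(ℝ, F) 𝓘(ℝ, E) ∞ ι) {q : C}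
    (hrank : HasConstantRankNear ι
      (fun q' => subTangent (F := F) ι q' ⊓ Ω.polar (subTangent (F := F) ι q')) q)
    {V : TangentSpace 𝓘(ℝ, E) (ι q)}
    (hV : V ∈ subTangent (F := F) ι q ⊓ Ω.polar (subTangent (F := F) ι q)) :
    ∃ (f : P → ℝ) (Y : ∀ q : C, TangentSpace 𝓘(ℝ, F) q),
      Ω.IsFirstClass F ι f ∧ IsSmoothField Y ∧
      Ω.IsHamiltonianFieldAlong F ι f (pushField ι Y) ∧ pushField ι Y q = V := by
  have hsrc := coord_sources_mem_nhds hι.contMDiff q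
  have hq := hsrc.self_of_nhds
  -- This is the pulled back form ι^*ω in coordinates; the injective dι carries its kernel onto TC ∩
  -- TC^⊥.
  let A (c : C) : F →L[ℝ] F →L[ℝ] ℝ := Ω.polarMap ι q c ∘L coordDeriv ι q c
  have hA : ∀ᶠ c in 𝓝 q, ContMDiffAt 𝓘(ℝ, F) 𝓘(ℝ, F →L[ℝ] F →L[ℝ] ℝ) ∞ A c := by
    filter_upwards [hsrc, Ω.contMDiffAt_polarMap (F := F) hι.contMDiff q] with c h1 h2
    exact ContMDiffAt.clm_comp h2 (contMDiffAt_coordDeriv hι.contMDiff h1.1 h1.2)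
  have hmem {c : C} (hc : c ∈ (chartAt F q).source ∧ ι c ∈ (chartAt E (ι q)).source)
      (Y : TangentSpace 𝓘(ℝ, F) c) :
      mfderiv 𝓘(ℝ, F) 𝓘(ℝ, E) ι c Y ∈ Ω.polar (subTangent (F := F) ι c) ↔
        A c (toCoord q c Y) = 0 := by
    rw [Ω.mem_polar_iff_polarMap hc.1 hc.2, toCoord_mfderiv hc.1]
    rfl
  have hker {c : C} (hc : c ∈ (chartAt F q).source ∧ ι c ∈ (chartAt E (ι q)).source) :
      Module.finrank ℝ (LinearMap.ker (A c).toLinearMap) = Module.finrank ℝ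
        (subTangent (F := F) ι c ⊓ Ω.polar (subTangent (F := F) ι c) :
          Submodule ℝ (TangentSpace 𝓘(ℝ, E) (ι c))) := by
    let d : TangentSpace 𝓘(ℝ, F) c →ₗ[ℝ] TangentSpace 𝓘(ℝ, E) (ι c) :=
      (mfderiv 𝓘(ℝ, F) 𝓘(ℝ, E) ι c).toLinearMap
    let j : F →ₗ[ℝ] TangentSpace 𝓘(ℝ, E) (ι c) := d ∘ₗ (coordEquiv hc.1).symm.toLinearMap
    have hj : Function.Injective j :=
      (IsSmoothEmbedding.mfderiv_injective hι c).comp (coordEquiv hc.1).symm.injective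
    have hmap : (LinearMap.ker (A c).toLinearMap).map j =
        subTangent (F := F) ι c ⊓ Ω.polar (subTangent (F := F) ι c) := by
      ext W
      constructor
      · rintro ⟨u, hu, rfl⟩
        refine ⟨⟨_, rfl⟩, (hmem hc _).2 ?_⟩
        rw [← LinearMap.mem_ker.1 hu]
        exact congrArg (A c) (toCoord_ofCoord hc.1 u)
      · rintro ⟨⟨Y, rfl⟩, hY⟩
        exact ⟨toCoord q c Y, (hmem hc Y).1 hY, congrArg d (ofCoord_toCoord hc.1 Y)⟩
    rw [(Submodule.equivMapOfInjective j hj _).finrank_eq, hmap]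
  obtain ⟨⟨Y₀, rfl⟩, hY₀⟩ := hV
  obtain ⟨u, hu, hu0, huq⟩ := exists_local_kernel_section hA
    (by
      filter_upwards [hsrc, hrank] with c h1 h2
      rw [hker h1, hker hq, h2])
    ((hmem hq Y₀).1 hY₀)
  obtain ⟨f, ρ, hf, hρ, hρq, hρN, h⟩ := Ω.exists_constraint_of_local_field hι
    (v := fun c => coordDeriv ι q c (u c))
    (by
      filter_upwards [hsrc, hu] with c h1 h2
      exact (contMDiffAt_coordDeriv hι.contMDiff h1.1 h1.2).clm_apply h2)
    (by
      filter_upwards [hsrc, hu0] with c h1 h2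
      rw [Ω.mem_polar_iff_polarMap h1.1 h1.2, toCoord_ofCoord h1.2]
      exact h2) (hsrc.and hu)
  let Y (c : C) : TangentSpace 𝓘(ℝ, F) c := ρ c • ofCoord q c (u c)
  have hY : IsSmoothField Y := contMDiff_smul_ofCoord contMDiff_id hρ
    fun c hc => ⟨(hρN hc).1.1, (hρN hc).2⟩
  have hYΩ (c : C) : Ω.IsHamiltonianVector f (pushField (E := E) ι Y c) := by
    -- The identity between `coordDeriv` and dι holds only over the chart; where the cut-off is
    -- nonzero the point lies there.
    by_cases hc : ρ c = 0
    · have h1 := h c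
      rw [hc, zero_smul] at h1
      simpa [pushField, Y, hc] using h1
    · have hc' := (hρN (subset_tsupport ρ hc)).1
      have h1 := h c
      rw [ofCoord_coordDeriv hc'.2, ← map_smul] at h1
      exact h1
  refine ⟨f, Y, ⟨hf, fun c => (hYΩ c).derivVanishesOn Ω ⟨Y c, rfl⟩⟩, hY,
    ⟨fun c => contMDiffAt_pushField hι.contMDiff (hY c), hYΩ⟩, ?_⟩
  have hYq : Y q = Y₀ := by
    simp only [Y]
    rw [hρq, one_smul, huq, ofCoord_toCoord hq.1]
  exact congrArg (mfderiv 𝓘(ℝ, F) 𝓘(ℝ, E) ι q) hYq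

end Fields

end

/-! ### Assembly of the four assertions. -/

theorem proposition6p12
    {E : Type*} [NormedAddCommGroup E] [NormedSpace ℝ E] [FiniteDimensional ℝ E]
    {P : Type*} [TopologicalSpace P] [T2Space P] [SecondCountableTopology P]
    [ChartedSpace E P] [IsManifold 𝓘(ℝ, E) ∞ P]
    (Ω : PresymplecticForm E P)
    {F : Type*} [NormedAddCommGroup F] [NormedSpace ℝ F] [FiniteDimensional ℝ F]
    {C : Type*} [TopologicalSpace C] [ChartedSpace F C] [IsManifold 𝓘(ℝ, F) ∞ C]
    (ι : C → P) (hι : IsSmoothEmbedding 𝓘(ℝ, F) 𝓘(ℝ, E) ∞ ι) :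
    -- (i), at each point, and for smooth vector fields where `TP^⊥` is regular
    (∀ f : P → ℝ, IsConstraint E ι f →
      ((∀ q : C, ∃ V : TangentSpace 𝓘(ℝ, E) (ι q), Ω.IsHamiltonianVector f V) ↔
        ∀ q : C, DerivVanishesOn f (Ω.polar (⊤ : Submodule ℝ (TangentSpace 𝓘(ℝ, E) (ι q))))) ∧
      ((∀ q : C, HasConstantRankNear ι
          (fun q' => Ω.polar (⊤ : Submodule ℝ (TangentSpace 𝓘(ℝ, E) (ι q')))) q) →
        ((∃ X, Ω.IsHamiltonianFieldAlong F ι f X) ↔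
          ∀ q : C, DerivVanishesOn f
            (Ω.polar (⊤ : Submodule ℝ (TangentSpace 𝓘(ℝ, E) (ι q)))))) ∧
      (∀ (q : C) (V : TangentSpace 𝓘(ℝ, E) (ι q)), Ω.IsHamiltonianVector f V →
        V ∈ Ω.polar (subTangent (F := F) ι q))) ∧
    -- (ii), at each point, and for smooth vector fields where `TC^⊥` is regular
    (∀ q : C,
      Submodule.span ℝ {V : TangentSpace 𝓘(ℝ, E) (ι q) |
          ∃ f, IsConstraint E ι f ∧ Ω.IsHamiltonianVector f V} =
        Ω.polar (subTangent (F := F) ι q) ∧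
      (HasConstantRankNear ι (fun q' => Ω.polar (subTangent (F := F) ι q')) q →
        Submodule.span ℝ {V : TangentSpace 𝓘(ℝ, E) (ι q) |
            ∃ f X, IsConstraint E ι f ∧ Ω.IsHamiltonianFieldAlong F ι f X ∧ X q = V} =
          Ω.polar (subTangent (F := F) ι q))) ∧
    -- (iii), at each point, and for smooth vector fields on `C` where `TC^⊥` is regular
    (∀ f : P → ℝ, Ω.IsFirstClass F ι f →
      (∀ q : C, ∃ V ∈ subTangent (F := F) ι q ⊓ Ω.polar (subTangent (F := F) ι q),
        Ω.IsHamiltonianVector f V) ∧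
      ((∀ q : C, HasConstantRankNear ι (fun q' => Ω.polar (subTangent (F := F) ι q')) q) →
        ∃ Y : ∀ q : C, TangentSpace 𝓘(ℝ, F) q, IsSmoothField Y ∧
          Ω.IsHamiltonianFieldAlong F ι f (pushField ι Y) ∧
          ∀ q : C, pushField ι Y q ∈ Ω.polar (subTangent (F := F) ι q))) ∧
    -- (iv), at the points near which `TC ∩ TC^⊥` is regular
    (∀ q : C,
      HasConstantRankNear ι
        (fun q' => subTangent (F := F) ι q' ⊓ Ω.polar (subTangent (F := F) ι q')) q →
      Submodule.span ℝ {V : TangentSpace 𝓘(ℝ, E) (ι q) |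
          ∃ (f : P → ℝ) (Y : ∀ q : C, TangentSpace 𝓘(ℝ, F) q),
            Ω.IsFirstClass F ι f ∧ IsSmoothField Y ∧
            Ω.IsHamiltonianFieldAlong F ι f (pushField ι Y) ∧ pushField ι Y q = V} =
        subTangent (F := F) ι q ⊓ Ω.polar (subTangent (F := F) ι q)) := by
  have hne : (∞ : WithTop ℕ∞) ≠ 0 := by simp
  have hιs := hι.contMDiff
  -- The embedding passes the Hausdorff and countability properties of `P` to `C`; with local
  -- compactness they give the σ-compactness needed for partitions of unity.
  have : T2Space C := hι.isEmbedding.t2Space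
  have : SecondCountableTopology C := hι.isEmbedding.secondCountableTopology
  have : LocallyCompactSpace C := Manifold.locallyCompact_of_finiteDimensional 𝓘(ℝ, F)
  have hpolar {f : P → ℝ} (hf : IsConstraint E ι f) {q : C} {V : TangentSpace 𝓘(ℝ, E) (ι q)}
      (hV : Ω.IsHamiltonianVector f V) : V ∈ Ω.polar (subTangent (F := F) ι q) :=
    hV.mem_polar Ω hf hιs
  refine ⟨fun f hf => ⟨⟨fun h q => ?_, fun h q => ?_⟩, fun hrank => ⟨?_, fun h => ?_⟩,
    fun q V => hpolar hf⟩, fun q => ⟨?_, fun hrank => ?_⟩, fun f hf => ⟨fun q => ?_, fun hrank => ?_⟩,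
    fun q hrank => ?_⟩
  · obtain ⟨V, hV⟩ := h q
    exact hV.derivVanishesOn Ω Submodule.mem_top
  · have hq := mem_chart_source E (ι q)
    obtain ⟨u, hu⟩ := Ω.exists_isHamiltonianVector hq (ContinuousLinearMap.id ℝ E)
      (Ω.mem_polar_top_iff hq) (h q)
    exact ⟨_, hu⟩
  · rintro ⟨X, hX⟩ q
    exact (hX.hamiltonian q).derivVanishesOn Ω Submodule.mem_top
  · exact Ω.exists_hamiltonianField hιs hf.smooth hrank h
  · refine le_antisymm (Submodule.span_le.2 ?_) fun V hV =>
      Submodule.subset_span (Ω.exists_constraint_of_mem_polar hι hV)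
    rintro V ⟨f, hf, hV⟩
    exact hpolar hf hV
  · refine le_antisymm (Submodule.span_le.2 ?_) fun V hV =>
      Submodule.subset_span (Ω.exists_hamiltonianField_of_mem_polar hι hrank hV)
    rintro _ ⟨f, X, hf, hX, rfl⟩
    exact hpolar hf (hX.hamiltonian q)
  · have hqF := mem_chart_source F q
    have hqE := mem_chart_source E (ι q)
    obtain ⟨u, hu⟩ := Ω.exists_isHamiltonianVector hqE (coordDeriv ι q q)
      (Ω.mem_polar_subTangent_iff hqF hqE) (hf.firstClass q)
    rw [ofCoord_coordDeriv hqE] at hu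
    exact ⟨_, ⟨⟨_, rfl⟩, hpolar hf.toIsConstraint hu⟩, hu⟩
  · obtain ⟨Y, hY, hYf⟩ := Ω.exists_tangent_hamiltonianField hιs hf.smooth hrank hf.firstClass
    exact ⟨Y, hY, hYf, fun q => hpolar hf.toIsConstraint (hYf.hamiltonian q)⟩
  · refine le_antisymm (Submodule.span_le.2 ?_) fun V hV =>
      Submodule.subset_span (Ω.exists_tangent_hamiltonianField_of_mem_inf hι hrank hV)
    rintro _ ⟨f, Y, hf, -, hY, rfl⟩
    exact ⟨⟨Y q, rfl⟩, hpolar hf.toIsConstraint (hY.hamiltonian q)⟩
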